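/- A plane graph here is a finite graph embedded in the plane (equivalently, on the sphere), considered up to homeomorphism; multiple edges are allowed, and the unbounded region counts as a face. For $i\in\{4,5,6,7,8\}$, an $i$-hedrite is a $2$-connected (that is, connected, with at least two vertices and without cut-vertex) $4$-valent plane graph, all of whose faces are $2$-, $3$- or $4$-gons, and which has exactly $8-i$ faces that are $2$-gons. A $j$-gon is a face whose boundary walk has length $j$. **Theorem.** Let $n$ be a non-negative integer. (i) A $4$-hedrite with $n$ vertices exists if and only if $n\ge 2$ and $n$ is even. (ii) A $5$-hedrite with $n$ vertices exists if and only if $n\ge 3$ and $n\ne 4$. (iii) A $6$-hedrite with $n$ vertices exists if and only if $n\ge 4$. (iv) A $7$-hedrite with $n$ vertices exists if and only if $n\ge 7$. (v) An $8$-hedrite with $n$ vertices exists if and only if $n\ge 6$ and $n\ne 7$. -/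

import Mathlib

/-- A (finite) rotation system, also called a combinatorial map: it encodes, up to homeomorphism, a
finite multigraph without isolated vertices cellularly embedded in closed oriented surfaces.
The darts are the half-edges (directed edges); `rot` sends a dart to the next dart, in the
counterclockwise order, at the same starting vertex; `opp` sends a dart to the other half of its
edge. Multiple edges and loops are allowed. -/
structure CombMap where
  Dart : Type
  [fintypeDart : Fintype Dart]
  rot : Equiv.Perm Dart
  opp : Equiv.Perm Dart
  opp_opp : ∀ d, opp (opp d) = d
  opp_ne : ∀ d, opp d ≠ d

namespace CombMap

/-- The set of cycles (orbits, fixed points included) of a permutation. -/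
abbrev Orbit {α : Type} (π : Equiv.Perm α) : Type :=
  Quotient (Equiv.Perm.SameCycle.setoid π)

/-- The orbit of an element under a permutation. -/
def orbitOf {α : Type} (π : Equiv.Perm α) (x : α) : Orbit π :=
  Quotient.mk (Equiv.Perm.SameCycle.setoid π) x

/-- The number of elements of an orbit. -/
noncomputable def orbitSize {α : Type} (π : Equiv.Perm α) (o : Orbit π) : ℕ :=
  Nat.card {x : α // orbitOf π x = o}

variable (G : CombMap)

/-- The face permutation: walk along the dart `d` to its other end and turn there to the
neighbouring dart in the rotation. Its orbits are the boundary walks of the faces. -/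
def facePerm : Equiv.Perm G.Dart := G.opp.trans G.rot

/-- Vertices, edges and faces (the unbounded face included). -/
abbrev Vertex : Type := Orbit G.rot
abbrev Edge : Type := Orbit G.opp
abbrev Face : Type := Orbit G.facePerm

noncomputable def numVertices : ℕ := Nat.card G.Vertex
noncomputable def numEdges : ℕ := Nat.card G.Edge
noncomputable def numFaces : ℕ := Nat.card G.Face

/-- The degree of a vertex: the number of half-edges at it (a loop counts twice). -/
noncomputable def degree (v : G.Vertex) : ℕ := orbitSize G.rot v

/-- The size of a face: the length of its boundary walk. -/
noncomputable def faceSize (f : G.Face) : ℕ := orbitSize G.facePerm f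

/-- `p_j`, the number of `j`-gonal faces. -/
noncomputable def pVector (j : ℕ) : ℕ := Nat.card {f : G.Face // G.faceSize f = j}

/-- The simple graph underlying the map (loops and multiplicities of edges are forgotten). -/
def underlying : SimpleGraph G.Vertex where
  Adj v w := v ≠ w ∧ ∃ d : G.Dart, orbitOf G.rot d = v ∧ orbitOf G.rot (G.opp d) = w
  symm := ⟨by
    rintro v w ⟨hne, d, hv, hw⟩
    exact ⟨hne.symm, G.opp d, hw, by rw [G.opp_opp]; exact hv⟩⟩
  loopless := ⟨fun _ h => h.1 rfl⟩

/-- The map is (connected and) embedded in the sphere, that is, it is a connected plane graph: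
connected with Euler characteristic `V - E + F = 2`. -/
def IsPlane : Prop :=
  G.underlying.Connected ∧ (G.numVertices : ℤ) - G.numEdges + G.numFaces = 2

/-- `2`-connectedness: connected, with no cut-vertex, and with at least two vertices (after the
deletion of any vertex a nonempty connected graph remains). -/
def IsTwoConnected : Prop :=
  G.underlying.Connected ∧ ∀ v : G.Vertex, (G.underlying.induce {v}ᶜ).Connected

/-- An `i`-hedrite: a `2`-connected `4`-valent plane graph all of whose faces are `2`-, `3`- or
`4`-gons and such that `p_2 = 8 - i`. -/
structure IsHedrite (i : ℕ) : Prop where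
  plane : G.IsPlane
  twoConnected : G.IsTwoConnected
  fourValent : ∀ v : G.Vertex, G.degree v = 4
  pVector_eq_zero : ∀ j : ℕ, j ≠ 2 → j ≠ 3 → j ≠ 4 → G.pVector j = 0
  pVector_two : (G.pVector 2 : ℤ) = 8 - i

end CombMap

/-! Double counting of darts together with Euler's formula gives `2 * p₂ + p₃ = 8`. An `i`-hedrite
with `n` vertices therefore has `p₃ = 2 * i - 8` and `p₄ = n + 2 - i`, and `p₄ ≥ 0` gives `n ≥ i -
2`. This bound is already sharp for `i = 6`. What remains to be excluded is odd `n` for `i = 4`, and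
the pairs `(i, n) = (5, 4), (7, 5), (7, 6), (8, 7)`.

In a `4`-hedrite all faces are even. The first cohomology modulo `2` of a connected map of Euler
characteristic `2` vanishes (`IsPlane.range_facePairing`), so the graph is bipartite; being
`4`-regular, it has colour classes of equal size. The four sporadic pairs fall to a backtracking
search over gluings of darts (`PartialTable.refute`), which is proved sound and run in the kernel.

For existence, a tube of `4`-gons is closed by two caps. A cap carries half of the total `8 = 2 * p₂
+ p₃`: two `2`-gons (A), one `2`-gon and two `3`-gons (B), or four `3`-gons (C). The pairs AA, AB,
BB, BC, CC give `i = 4, 5, 6, 7, 8`. A map is stored as a table of opposite darts. Short tubes are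
checked by evaluation; longer ones arise from a sufficiently long one by inserting periods of the
tube (`IsPeriodicTable.isHedriteTable_insertTable`). The doubled `4`-cycle-free case `n = 2` and the
octahedron are given by separate tables. -/

namespace CombMap

attribute [instance] CombMap.fintypeDart

/-! ### Counting over the orbits of a permutation. -/

section Orbits

variable {α : Type} (π : Equiv.Perm α)

theorem orbitOf_eq_iff {x y : α} : orbitOf π x = orbitOf π y ↔ π.SameCycle x y :=
  Quotient.eq (r := Equiv.Perm.SameCycle.setoid π)

theorem orbitOf_surjective : Function.Surjective (orbitOf π) := Quotient.mk_surjective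

theorem orbitOf_apply (x : α) : orbitOf π (π x) = orbitOf π x :=
  (orbitOf_eq_iff π).2 (Equiv.Perm.sameCycle_apply_left.2 (Equiv.Perm.SameCycle.refl π x))

/-- Sums over the orbits, when all orbits have size `2`, `3` or `4`. -/
theorem sum_orbit_of_size_mem [Fintype (Orbit π)] (g : ℕ → ℕ)
    (h : ∀ o : Orbit π, orbitSize π o = 2 ∨ orbitSize π o = 3 ∨ orbitSize π o = 4) :
    ∑ o : Orbit π, g (orbitSize π o) =
      Nat.card {o : Orbit π // orbitSize π o = 2} * g 2 +
      Nat.card {o : Orbit π // orbitSize π o = 3} * g 3 +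
      Nat.card {o : Orbit π // orbitSize π o = 4} * g 4 := by
  classical
  have key : ∀ j, Nat.card {o : Orbit π // orbitSize π o = j} * g j =
      ∑ o : Orbit π, if orbitSize π o = j then g j else 0 := by
    intro j
    rw [← Finset.sum_filter, Finset.sum_const, Nat.card_eq_fintype_card, Fintype.card_subtype,
      smul_eq_mul]
  rw [key, key, key, ← Finset.sum_add_distrib, ← Finset.sum_add_distrib]
  refine Finset.sum_congr rfl fun o _ => ?_
  rcases h o with h | h | h <;> simp [h]

variable [Finite α]

instance : Finite (Orbit π) := Finite.of_surjective _ (orbitOf_surjective π)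

theorem orbitSize_orbitOf (x : α) : orbitSize π (orbitOf π x) = Function.minimalPeriod π x := by
  have := Fintype.ofFinite (MulAction.orbit (Subgroup.zpowers π) x)
  have h := MulAction.minimalPeriod_eq_card (a := π) (b := x)
  refine Eq.trans ?_ (h.symm.trans rfl)
  rw [← Nat.card_eq_fintype_card]
  refine Nat.card_congr (Equiv.subtypeEquivRight fun y => ?_)
  rw [orbitOf_eq_iff, Equiv.Perm.sameCycle_comm, MulAction.mem_orbit_iff]
  constructor
  · rintro ⟨k, hk⟩
    exact ⟨⟨π ^ k, k, rfl⟩, hk⟩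
  · rintro ⟨⟨_, k, rfl⟩, hk⟩
    exact ⟨k, hk⟩

theorem sum_orbitSize [Fintype (Orbit π)] : ∑ o, orbitSize π o = Nat.card α := by
  rw [← Nat.card_congr (Equiv.sigmaFiberEquiv (orbitOf π)), Nat.card_sigma]
  rfl

theorem card_subtype_orbitOf {P : Orbit π → Prop} {c : ℕ} (hP : ∀ o, P o → orbitSize π o = c) :
    Nat.card {x // P (orbitOf π x)} = c * Nat.card {o // P o} := by
  classical
  have := Fintype.ofFinite (Orbit π)
  rw [← Nat.card_congr (Equiv.sigmaFiberEquiv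
    (fun x : {x // P (orbitOf π x)} => (⟨orbitOf π x, x.2⟩ : {o // P o}))), Nat.card_sigma,
    Finset.sum_const_nat (m := c)]
  · rw [Finset.card_univ, Nat.card_eq_fintype_card, mul_comm]
  · rintro ⟨o, ho⟩ -
    rw [← hP o ho]
    exact Nat.card_congr ⟨fun x => ⟨x.1.1, congrArg Subtype.val x.2⟩,
      fun x => ⟨⟨x.1, by rw [x.2]; exact ho⟩, Subtype.ext x.2⟩, fun _ => rfl, fun _ => rfl⟩

theorem card_orbitSize_eq (j : ℕ) :
    Nat.card {x // orbitSize π (orbitOf π x) = j} =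
      j * Nat.card {o : Orbit π // orbitSize π o = j} :=
  card_subtype_orbitOf π fun _ => id

theorem card_eq_mul_card_orbit {c : ℕ} (h : ∀ o : Orbit π, orbitSize π o = c) :
    Nat.card α = c * Nat.card (Orbit π) := by
  have := Fintype.ofFinite (Orbit π)
  rw [← sum_orbitSize π, Finset.sum_const_nat fun o _ => h o, Finset.card_univ,
    Nat.card_eq_fintype_card, mul_comm]

theorem card_of_size_mem
    (h : ∀ o : Orbit π, orbitSize π o = 2 ∨ orbitSize π o = 3 ∨ orbitSize π o = 4) :
    Nat.card (Orbit π) = Nat.card {o : Orbit π // orbitSize π o = 2} +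
      Nat.card {o : Orbit π // orbitSize π o = 3} + Nat.card {o : Orbit π // orbitSize π o = 4} ∧
    Nat.card α = 2 * Nat.card {o : Orbit π // orbitSize π o = 2} +
      3 * Nat.card {o : Orbit π // orbitSize π o = 3} +
      4 * Nat.card {o : Orbit π // orbitSize π o = 4} := by
  have := Fintype.ofFinite (Orbit π)
  constructor
  · have := sum_orbit_of_size_mem π (fun _ => 1) h
    simpa [Nat.card_eq_fintype_card] using this
  · have := sum_orbit_of_size_mem π (fun j => j) h
    rw [← sum_orbitSize π, this]
    ring

end Orbits

theorem minimalPeriod_eq_two_iff {α : Type} {f : α → α} {x : α} :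
    Function.minimalPeriod f x = 2 ↔ f (f x) = x ∧ f x ≠ x := by
  have : Fact (Nat.Prime 2) := ⟨Nat.prime_two⟩
  exact Function.minimalPeriod_eq_prime_iff

theorem minimalPeriod_eq_three_iff {α : Type} {f : α → α} {x : α} :
    Function.minimalPeriod f x = 3 ↔ f (f (f x)) = x ∧ f x ≠ x := by
  have : Fact (Nat.Prime 3) := ⟨Nat.prime_three⟩
  exact Function.minimalPeriod_eq_prime_iff

/-- As `4` is a prime power, the second iterate alone rules out all proper divisors. -/
theorem minimalPeriod_eq_four_iff {α : Type} {f : α → α} {x : α} :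
    Function.minimalPeriod f x = 4 ↔ f (f (f (f x))) = x ∧ f (f x) ≠ x := by
  constructor
  · intro h
    refine ⟨?_, fun h2 => ?_⟩
    · have := Function.isPeriodicPt_minimalPeriod f x
      rw [h] at this
      exact this
    · have : Function.IsPeriodicPt f 2 x := h2
      have := this.minimalPeriod_le two_pos
      omega
  · rintro ⟨h4, h2⟩
    have : Fact (Nat.Prime 2) := ⟨Nat.prime_two⟩
    exact Function.minimalPeriod_eq_prime_pow (p := 2) (k := 1) (f := f) (x := x) h2 h4

/-! ### Face numbers from Euler's formula. -/

section Counts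

variable {G : CombMap}

theorem edge_size (e : G.Edge) : orbitSize G.opp e = 2 := by
  obtain ⟨d, rfl⟩ := orbitOf_surjective _ e
  rw [orbitSize_orbitOf, minimalPeriod_eq_two_iff]
  exact ⟨G.opp_opp d, G.opp_ne d⟩

theorem card_dart_eq_two_mul : Nat.card G.Dart = 2 * G.numEdges :=
  card_eq_mul_card_orbit _ edge_size

theorem card_dart_eq_four_mul (h : ∀ v : G.Vertex, G.degree v = 4) :
    Nat.card G.Dart = 4 * G.numVertices :=
  card_eq_mul_card_orbit _ h

namespace IsHedrite

variable {i : ℕ} (h : G.IsHedrite i)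

include h

theorem faceSize_mem (f : G.Face) :
    orbitSize G.facePerm f = 2 ∨ orbitSize G.facePerm f = 3 ∨ orbitSize G.facePerm f = 4 := by
  by_contra! hf
  have := h.pVector_eq_zero (G.faceSize f) hf.1 hf.2.1 hf.2.2
  rw [pVector, Nat.card_eq_zero] at this
  rcases this with this | this
  · exact this.elim ⟨f, rfl⟩
  · exact absurd (inferInstance : Finite {g : G.Face // G.faceSize g = G.faceSize f})
      (not_finite_iff_infinite.2 this)

theorem card_dart : Nat.card G.Dart = 4 * G.numVertices := card_dart_eq_four_mul h.fourValent

theorem pVector_two_add : G.pVector 2 + i = 8 := by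
  have := h.pVector_two
  omega

theorem face_counts : G.numFaces = G.pVector 2 + G.pVector 3 + G.pVector 4 ∧
    Nat.card G.Dart = 2 * G.pVector 2 + 3 * G.pVector 3 + 4 * G.pVector 4 :=
  card_of_size_mem G.facePerm h.faceSize_mem

theorem pVector_three_add : G.pVector 3 + 8 = 2 * i := by
  have h1 := h.face_counts
  have h2 := h.card_dart
  have h3 := card_dart_eq_two_mul (G := G)
  have h4 := h.plane.2
  have h5 := h.pVector_two_add
  omega

theorem pVector_four_add : G.pVector 4 + i = G.numVertices + 2 := by
  have h1 := h.face_counts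
  have h2 := h.card_dart
  have h3 := card_dart_eq_two_mul (G := G)
  have h4 := h.plane.2
  have h5 := h.pVector_two_add
  omega

end IsHedrite

end Counts

end CombMap

/-! ### Two-connectedness from a numbering of the vertices. -/

/-- A graph whose vertices are numbered in such a way that every vertex but the first has a smaller
neighbour, every vertex but the last has a larger neighbour, and every other vertex is jumped over
by an edge, is connected and has no cut-vertex. -/
theorem SimpleGraph.connected_and_induce_compl_connected_of_numbering {V : Type*}
    (H : SimpleGraph V) {N : ℕ} (hN : 2 ≤ N) (e : ℕ → V)
    (surj : ∀ v, ∃ j < N, e j = v) (inj : ∀ a < N, ∀ b < N, e a = e b → a = b)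
    (smaller : ∀ j < N, 0 < j → ∃ a < j, H.Adj (e j) (e a))
    (larger : ∀ j, j + 1 < N → ∃ b, j < b ∧ b < N ∧ H.Adj (e j) (e b))
    (jump : ∀ j, 0 < j → j + 1 < N → ∃ a b, a < j ∧ j < b ∧ b < N ∧ H.Adj (e a) (e b)) :
    H.Connected ∧ ∀ v, (H.induce {v}ᶜ).Connected := by
  constructor
  · have down : ∀ j < N, H.Reachable (e j) (e 0) := by
      intro j
      induction j using Nat.strong_induction_on with
      | _ j ih =>
        intro hj
        rcases Nat.eq_zero_or_pos j with rfl | h0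
        · exact SimpleGraph.Reachable.refl _
        · obtain ⟨a, ha, hadj⟩ := smaller j hj h0
          exact hadj.reachable.trans (ih a ha (by omega))
    refine SimpleGraph.connected_iff_exists_forall_reachable _ |>.2 ⟨e 0, fun v => ?_⟩
    obtain ⟨j, hj, rfl⟩ := surj v
    exact (down j hj).symm
  · intro v
    obtain ⟨k, hk, rfl⟩ := surj v
    have hne : ∀ a < N, a ≠ k → e a ∈ ({e k}ᶜ : Set V) := fun a ha hak h =>
      hak (inj a ha k hk h)
    -- After deletion of vertex `k`, descending paths from below `k` and ascending paths from above
    -- `k` never meet it. So there are at most two pieces, containing the vertices `0` and `N - 1`.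
    have down : ∀ j, ∀ h : j < k, (H.induce {e k}ᶜ).Reachable
        ⟨e j, hne j (by omega) (by omega)⟩ ⟨e 0, hne 0 (by omega) (by omega)⟩ := by
      intro j
      induction j using Nat.strong_induction_on with
      | _ j ih =>
        intro hj
        rcases Nat.eq_zero_or_pos j with rfl | h0
        · exact SimpleGraph.Reachable.refl _
        · obtain ⟨a, ha, hadj⟩ := smaller j (by omega) h0
          refine SimpleGraph.Reachable.trans (SimpleGraph.Adj.reachable ?_) (ih a ha (by omega))
          exact hadj
    have up : ∀ l j, j + l + 1 = N → ∀ (h : j < N) (_ : k < j), (H.induce {e k}ᶜ).Reachable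
        ⟨e j, hne j (by omega) (by omega)⟩ ⟨e (N - 1), hne (N - 1) (by omega) (by omega)⟩ := by
      intro l
      induction l using Nat.strong_induction_on with
      | _ l ih =>
        intro j hl hj hkj
        rcases Nat.eq_zero_or_pos l with rfl | h0
        · have : j = N - 1 := by omega
          subst this
          exact SimpleGraph.Reachable.refl _
        · obtain ⟨b, hb, hbN, hadj⟩ := larger j (by omega)
          refine SimpleGraph.Reachable.trans (SimpleGraph.Adj.reachable ?_)
            (ih (N - 1 - b) (by omega) b (by omega) hbN (by omega))
          exact hadj
    rw [SimpleGraph.connected_iff_exists_forall_reachable]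
    rcases Nat.eq_zero_or_pos k with rfl | h0
    · refine ⟨⟨e (N - 1), hne (N - 1) (by omega) (by omega)⟩, ?_⟩
      rintro ⟨w, hw⟩
      obtain ⟨j, hj, rfl⟩ := surj w
      have : j ≠ 0 := fun h => hw (by rw [h]; rfl)
      exact (up (N - 1 - j) j (by omega) hj (by omega)).symm
    · refine ⟨⟨e 0, hne 0 (by omega) (by omega)⟩, ?_⟩
      rintro ⟨w, hw⟩
      obtain ⟨j, hj, rfl⟩ := surj w
      have hjk : j ≠ k := fun h => hw (by rw [h]; rfl)
      rcases Nat.lt_or_gt_of_ne hjk with h | h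
      · exact (down j h).symm
      -- The edge jumping over `k` joins the lower piece to the upper one.
      · obtain ⟨a, b, ha, hb, hbN, hadj⟩ := jump k h0 (by omega)
        refine ((up (N - 1 - j) j (by omega) hj h).trans ?_).symm
        refine (up (N - 1 - b) b (by omega) hbN hb).symm.trans ?_
        refine SimpleGraph.Reachable.trans (SimpleGraph.Adj.reachable ?_) (down a ha)
        exact hadj.symm

/-! ### Maps given by tables of opposite darts. -/

/-- The dart after `d` in the rotation at its vertex, where the darts at the vertex `j` are numbered
`4 * j`, `4 * j + 1`, `4 * j + 2`, `4 * j + 3`. -/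
def nextDart (d : ℕ) : ℕ := 4 * (d / 4) + (d + 1) % 4

/-- The face permutation belonging to the table `f` of opposite darts. -/
def faceStep (f : ℕ → ℕ) (d : ℕ) : ℕ := nextDart (f d)

/-- The table `f` of opposite darts describes an `i`-hedrite with the vertices `0, …, N - 1`. -/
structure IsHedriteTable (i N : ℕ) (f : ℕ → ℕ) : Prop where
  two_le : 2 ≤ N
  lt : ∀ d < 4 * N, f d < 4 * N
  invol : ∀ d < 4 * N, f (f d) = d
  ne : ∀ d < 4 * N, f d ≠ d
  face_ne : ∀ d < 4 * N, faceStep f d ≠ d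
  face : ∀ d < 4 * N, (faceStep f)^[2] d = d ∨ (faceStep f)^[3] d = d ∨ (faceStep f)^[4] d = d
  -- The darts on `2`-gons number `2 * (8 - i)`, and those on `3`-gons `3 * (2 * i - 8)`.
  two : Nat.count (fun d => (faceStep f)^[2] d = d) (4 * N) + 2 * i = 16
  three : Nat.count (fun d => (faceStep f)^[3] d = d) (4 * N) + 24 = 6 * i
  smaller : ∀ j < N, 0 < j → ∃ r < 4, f (4 * j + r) < 4 * j
  larger : ∀ j < N, j + 1 < N → ∃ r < 4, 4 * j + 4 ≤ f (4 * j + r)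
  jump : ∀ j < N, 0 < j → j + 1 < N → ∃ d < 4 * j, 4 * j + 4 ≤ f d

/-- Applied to numerical invariants, and also to `Prop`-valued `g`, where it says that an invariant
set is a union of cycles. -/
theorem Equiv.Perm.SameCycle.apply_eq {α β : Type*} {π : Equiv.Perm α} {g : α → β}
    (hg : ∀ x, g (π x) = g x) {x y : α} (h : π.SameCycle x y) : g x = g y := by
  obtain ⟨k, rfl⟩ := h
  have hpow : ∀ (m : ℕ) x, g ((π ^ m) x) = g x := by
    intro m
    induction m with
    | zero => intro x; rfl
    | succ m ih => intro x; rw [pow_succ', Equiv.Perm.mul_apply, hg, ih]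
  rcases Int.eq_nat_or_neg k with ⟨m, rfl | rfl⟩
  · rw [zpow_natCast, hpow]
  · conv_lhs => rw [show x = (π ^ m) ((π ^ (-(m : ℤ))) x) by
      rw [← zpow_natCast, ← Equiv.Perm.mul_apply, ← zpow_add]; simp]
    rw [hpow]

theorem Nat.card_subtype_eq_count {α : Type*} (p : ℕ → Prop) [DecidablePred p] {n : ℕ}
    (e : α ≃ Fin n) : Nat.card {x // p (e x)} = Nat.count p n := by
  rw [Nat.count_eq_card_filter_range, ← Nat.card_eq_finsetCard]
  refine Nat.card_congr ⟨fun x => ⟨e x.1, by simpa using x.2⟩,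
    fun x => ⟨e.symm ⟨x.1, ?_⟩, ?_⟩, fun x => ?_, fun x => ?_⟩
  · exact Finset.mem_range.1 (Finset.mem_filter.1 x.2).1
  · simpa using (Finset.mem_filter.1 x.2).2
  · simp
  · simp

namespace IsHedriteTable

variable {i N : ℕ} {f : ℕ → ℕ} (h : IsHedriteTable i N f)

/-- The rotation system with a given table of opposite darts. -/
def toCombMap : CombMap where
  Dart := Fin (4 * N)
  rot :=
    { toFun := fun d => ⟨nextDart d, by have := d.2; unfold nextDart; omega⟩
      invFun := fun d => ⟨4 * (d / 4) + (d + 3) % 4, by have := d.2; omega⟩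
      left_inv := fun d => Fin.ext (by simp only [nextDart]; omega)
      right_inv := fun d => Fin.ext (by simp only [nextDart]; omega) }
  opp :=
    { toFun := fun d => ⟨f d, h.lt d d.2⟩
      invFun := fun d => ⟨f d, h.lt d d.2⟩
      left_inv := fun d => Fin.ext (h.invol d d.2)
      right_inv := fun d => Fin.ext (h.invol d d.2) }
  opp_opp := fun d => Fin.ext (h.invol d d.2)
  opp_ne := fun d hd => h.ne d d.2 (congrArg Fin.val hd)

/-- The numbers of the darts. -/
def code : h.toCombMap.Dart ≃ Fin (4 * N) := Equiv.refl _

/-- The dart with a given number. -/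
def dart (k : ℕ) (hk : k < 4 * N) : h.toCombMap.Dart := h.code.symm ⟨k, hk⟩

theorem code_dart (k : ℕ) (hk : k < 4 * N) : (h.code (h.dart k hk) : ℕ) = k := rfl

theorem code_rot (d : h.toCombMap.Dart) :
    (h.code (h.toCombMap.rot d) : ℕ) = nextDart (h.code d) := rfl

theorem code_opp (d : h.toCombMap.Dart) : (h.code (h.toCombMap.opp d) : ℕ) = f (h.code d) := rfl

theorem eq_iff_code (d e : h.toCombMap.Dart) : d = e ↔ (h.code d : ℕ) = h.code e := by
  rw [← Fin.ext_iff, h.code.apply_eq_iff_eq]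

theorem code_facePerm_iterate (k : ℕ) (d : h.toCombMap.Dart) :
    (h.code ((h.toCombMap.facePerm)^[k] d) : ℕ) = (faceStep f)^[k] (h.code d) := by
  induction k generalizing d with
  | zero => rfl
  | succ k ih => exact ih (h.toCombMap.facePerm d)

theorem facePerm_iterate_eq_iff (k : ℕ) (d : h.toCombMap.Dart) :
    (h.toCombMap.facePerm)^[k] d = d ↔ (faceStep f)^[k] (h.code d) = h.code d := by
  rw [← h.code_facePerm_iterate, eq_iff_code]

theorem orbitOf_rot_eq_iff (x y : h.toCombMap.Dart) :
    CombMap.orbitOf h.toCombMap.rot x = CombMap.orbitOf h.toCombMap.rot y ↔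
      (h.code x : ℕ) / 4 = h.code y / 4 := by
  constructor
  · intro hxy
    refine Equiv.Perm.SameCycle.apply_eq (g := fun d => (h.code d : ℕ) / 4) (fun d => ?_)
      ((CombMap.orbitOf_eq_iff _).1 hxy)
    simp only [code_rot, nextDart]
    omega
  · intro hxy
    have step := fun d => CombMap.orbitOf_apply h.toCombMap.rot d
    have cases : y = x ∨ y = h.toCombMap.rot x ∨ y = h.toCombMap.rot (h.toCombMap.rot x) ∨
        y = h.toCombMap.rot (h.toCombMap.rot (h.toCombMap.rot x)) := by
      simp only [eq_iff_code, code_rot, nextDart]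
      omega
    rcases cases with rfl | rfl | rfl | rfl <;> simp only [step]

theorem degree_eq (v : h.toCombMap.Vertex) : h.toCombMap.degree v = 4 := by
  obtain ⟨d, rfl⟩ := CombMap.orbitOf_surjective _ v
  rw [CombMap.degree, CombMap.orbitSize_orbitOf, CombMap.minimalPeriod_eq_four_iff]
  simp only [ne_eq, eq_iff_code, code_rot, nextDart]
  omega

theorem card_dart : Nat.card h.toCombMap.Dart = 4 * N := by
  rw [Nat.card_congr h.code, Nat.card_fin]

theorem numVertices_eq : h.toCombMap.numVertices = N := by
  have h1 := CombMap.card_dart_eq_four_mul h.degree_eq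
  have h2 := h.card_dart
  omega

theorem faceSize_orbitOf_eq_iff (d : h.toCombMap.Dart) :
    (h.toCombMap.faceSize (CombMap.orbitOf _ d) = 2 ↔
      (faceStep f)^[2] (h.code d) = h.code d) ∧
    (h.toCombMap.faceSize (CombMap.orbitOf _ d) = 3 ↔
      (faceStep f)^[3] (h.code d) = h.code d) ∧
    (h.toCombMap.faceSize (CombMap.orbitOf _ d) = 4 ↔
      (faceStep f)^[4] (h.code d) = h.code d ∧ (faceStep f)^[2] (h.code d) ≠ h.code d) := by
  have hne : h.toCombMap.facePerm d ≠ d := fun hd =>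
    h.face_ne _ (h.code d).2 ((h.facePerm_iterate_eq_iff 1 d).1 hd)
  rw [CombMap.faceSize, CombMap.orbitSize_orbitOf, CombMap.minimalPeriod_eq_two_iff,
    CombMap.minimalPeriod_eq_three_iff, CombMap.minimalPeriod_eq_four_iff, ne_eq (_^[2] _),
    ← h.facePerm_iterate_eq_iff, ← h.facePerm_iterate_eq_iff, ← h.facePerm_iterate_eq_iff]
  exact ⟨⟨fun a => a.1, fun a => ⟨a, hne⟩⟩, ⟨fun a => a.1, fun a => ⟨a, hne⟩⟩, Iff.rfl⟩

theorem faceSize_mem (F : h.toCombMap.Face) :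
    h.toCombMap.faceSize F = 2 ∨ h.toCombMap.faceSize F = 3 ∨ h.toCombMap.faceSize F = 4 := by
  obtain ⟨d, rfl⟩ := CombMap.orbitOf_surjective _ F
  have h1 := h.faceSize_orbitOf_eq_iff d
  rw [h1.1, h1.2.1, h1.2.2]
  have h2 := h.face _ (h.code d).2
  tauto

theorem pVector_two_add : h.toCombMap.pVector 2 + i = 8 := by
  have h1 : _ = 2 * h.toCombMap.pVector 2 := CombMap.card_orbitSize_eq h.toCombMap.facePerm 2
  have h2 := h.two
  rw [← Nat.card_subtype_eq_count _ h.code,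
    ← Nat.card_congr (Equiv.subtypeEquivRight fun d => (h.faceSize_orbitOf_eq_iff d).1)] at h2
  simp only [CombMap.faceSize] at h2
  omega

theorem pVector_three_add : h.toCombMap.pVector 3 + 8 = 2 * i := by
  have h1 : _ = 3 * h.toCombMap.pVector 3 := CombMap.card_orbitSize_eq h.toCombMap.facePerm 3
  have h2 := h.three
  rw [← Nat.card_subtype_eq_count _ h.code,
    ← Nat.card_congr (Equiv.subtypeEquivRight fun d => (h.faceSize_orbitOf_eq_iff d).2.1)] at h2
  simp only [CombMap.faceSize] at h2
  omega

/-- The vertex with a given number. -/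
def vertex (hN : 2 ≤ N) (j : ℕ) : h.toCombMap.Vertex :=
  CombMap.orbitOf h.toCombMap.rot
    (h.dart (4 * (j % N)) (by have := Nat.mod_lt j (by omega : N > 0); omega))

theorem vertex_eq_orbitOf_iff (hN : 2 ≤ N) {j : ℕ} (hj : j < N) (d : h.toCombMap.Dart) :
    h.vertex hN j = CombMap.orbitOf h.toCombMap.rot d ↔ j = h.code d / 4 := by
  rw [vertex, orbitOf_rot_eq_iff, code_dart, Nat.mod_eq_of_lt hj]
  omega

theorem adj (hN : 2 ≤ N) {a b d : ℕ} (ha : a < N) (hb : b < N) (hab : a ≠ b) (hda : d / 4 = a)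
    (hdb : f d / 4 = b) : h.toCombMap.underlying.Adj (h.vertex hN a) (h.vertex hN b) := by
  have hd : d < 4 * N := by omega
  refine ⟨fun hh => hab ?_, h.dart d hd, ?_, ?_⟩
  · rw [vertex, vertex, orbitOf_rot_eq_iff, code_dart, code_dart, Nat.mod_eq_of_lt ha,
      Nat.mod_eq_of_lt hb] at hh
    omega
  · rw [eq_comm, vertex_eq_orbitOf_iff _ _ ha, code_dart, hda]
  · rw [eq_comm, vertex_eq_orbitOf_iff _ _ hb, code_opp, code_dart, hdb]

theorem twoConnected : h.toCombMap.IsTwoConnected := by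
  have hN := h.two_le
  refine SimpleGraph.connected_and_induce_compl_connected_of_numbering h.toCombMap.underlying
    hN (h.vertex hN) ?_ ?_ ?_ ?_ ?_
  · intro v
    obtain ⟨d, rfl⟩ := CombMap.orbitOf_surjective _ v
    have := (h.code d).2
    exact ⟨h.code d / 4, by omega, (h.vertex_eq_orbitOf_iff hN (by omega) d).2 rfl⟩
  · intro a ha b hb hab
    have := (h.vertex_eq_orbitOf_iff hN ha _).1 hab
    rw [code_dart, Nat.mod_eq_of_lt hb] at this
    omega
  · intro j hj h0
    obtain ⟨r, hr, hlt⟩ := h.smaller j hj h0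
    exact ⟨f (4 * j + r) / 4, by omega,
      h.adj hN (d := 4 * j + r) hj (by omega) (by omega) (by omega) rfl⟩
  · intro j hj
    obtain ⟨r, hr, hlt⟩ := h.larger j (by omega) hj
    have := h.lt (4 * j + r) (by omega)
    exact ⟨f (4 * j + r) / 4, by omega, by omega,
      h.adj hN (d := 4 * j + r) (by omega) (by omega) (by omega) (by omega) rfl⟩
  · intro j h0 hj
    obtain ⟨d, hd, hlt⟩ := h.jump j (by omega) h0 hj
    have := h.lt d (by omega)
    exact ⟨d / 4, f d / 4, by omega, by omega, by omega,
      h.adj hN (d := d) (by omega) (by omega) (by omega) rfl rfl⟩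

theorem isHedrite : h.toCombMap.IsHedrite i where
  plane := by
    refine ⟨h.twoConnected.1, ?_⟩
    -- Prescribing both `p₂` and `p₃` is what yields planarity: with `4 * N` darts they determine
    -- `p₄`, hence `F = N + 2`, while `E = 2 * N`.
    have h1 : h.toCombMap.numFaces = h.toCombMap.pVector 2 + h.toCombMap.pVector 3 +
          h.toCombMap.pVector 4 ∧ Nat.card h.toCombMap.Dart = 2 * h.toCombMap.pVector 2 +
          3 * h.toCombMap.pVector 3 + 4 * h.toCombMap.pVector 4 :=
      CombMap.card_of_size_mem h.toCombMap.facePerm h.faceSize_mem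
    have h2 := h.numVertices_eq
    have h3 := CombMap.card_dart_eq_two_mul (G := h.toCombMap)
    have h4 := CombMap.card_dart_eq_four_mul h.degree_eq
    have h5 := h.pVector_two_add
    have h6 := h.pVector_three_add
    omega
  twoConnected := h.twoConnected
  fourValent := h.degree_eq
  pVector_eq_zero := by
    intro j h2 h3 h4
    have : IsEmpty {F : h.toCombMap.Face // h.toCombMap.faceSize F = j} := by
      refine ⟨fun F => ?_⟩
      have h5 := F.2
      have h6 := h.faceSize_mem F.1
      omega
    exact Nat.card_of_isEmpty
  pVector_two := by
    have := h.pVector_two_add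
    omega

theorem exists_isHedrite (h : IsHedriteTable i N f) :
    ∃ G : CombMap, G.IsHedrite i ∧ G.numVertices = N :=
  ⟨h.toCombMap, h.isHedrite, h.numVertices_eq⟩

end IsHedriteTable

/-! ### Lengthening a tube by one period. -/

theorem Nat.count_congr_of_lt {p q : ℕ → Prop} [DecidablePred p] [DecidablePred q] {n : ℕ}
    (h : ∀ k < n, (p k ↔ q k)) : Nat.count p n = Nat.count q n := by
  rw [Nat.count_eq_card_filter_range, Nat.count_eq_card_filter_range]
  exact congrArg _ (Finset.filter_congr fun k hk => h k (Finset.mem_range.1 hk))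

/-- A table of opposite darts that is periodic, with period `4 * t`, on `lo ≤ d < hi`, and in which
the faces at the darts before `mid` stay below `hi`, while the faces at the later darts, and at the
`4 * t` darts just before `mid`, stay above `lo - 4 * t`. -/
structure IsPeriodicTable (t lo mid hi : ℕ) (N : ℕ) (f : ℕ → ℕ) : Prop where
  lt_mid : 4 * t < mid
  mid_lt : mid < 4 * N
  mid_dvd : 4 ∣ mid
  lo_dvd : 4 ∣ lo
  hi_dvd : 4 ∣ hi
  lo_le : lo ≤ mid
  mid_le : mid ≤ hi
  hi_le : hi ≤ 4 * N
  periodic : ∀ d < hi, lo ≤ d → f d = f (d - 4 * t) + 4 * t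
  below : ∀ d < mid, ∀ k < 4, f ((faceStep f)^[k] d) < hi
  above : ∀ d < 4 * N, mid ≤ d + 4 * t → ∀ k < 4, lo ≤ f ((faceStep f)^[k] d) + 4 * t
  two : ∀ d < mid, mid ≤ d + 4 * t → (faceStep f)^[2] d ≠ d
  three : ∀ d < mid, mid ≤ d + 4 * t → (faceStep f)^[3] d ≠ d

/-- The table obtained by inserting `t` vertices in front of the dart `hi`. -/
def insertTable (t hi : ℕ) (f : ℕ → ℕ) (d : ℕ) : ℕ :=
  if d < hi then f d else f (d - 4 * t) + 4 * t

namespace IsPeriodicTable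

variable {t lo mid hi N : ℕ} {f : ℕ → ℕ}

theorem insertTable_of_lt {d : ℕ} (hd : d < hi) : insertTable t hi f d = f d := if_pos hd

/-- From `lo` on, the new table is the old one translated by `4 * t`: below `hi` this is
periodicity, above it the definition. Before `hi` the new table is the old one, so the two
descriptions overlap and each face can be seen inside one of them. -/
theorem insertTable_add (h : IsPeriodicTable t lo mid hi N f) {d : ℕ} (hd : lo ≤ d + 4 * t) :
    insertTable t hi f (d + 4 * t) = f d + 4 * t := by
  unfold insertTable
  split_ifs with h1
  · rw [h.periodic _ h1 hd, Nat.add_sub_cancel]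
  · rw [Nat.add_sub_cancel]

theorem nextDart_lt {c d : ℕ} (hc : 4 ∣ c) (hd : d < c) : nextDart d < c := by
  unfold nextDart
  omega

theorem le_nextDart_add {c d t : ℕ} (hc : 4 ∣ c) (hd : c ≤ d + 4 * t) :
    c ≤ nextDart d + 4 * t := by
  unfold nextDart
  omega

theorem nextDart_add (d t : ℕ) : nextDart (d + 4 * t) = nextDart d + 4 * t := by
  unfold nextDart
  omega

variable (h : IsPeriodicTable t lo mid hi N f)

include h

theorem iterate_lt {d : ℕ} (hd : d < mid) (k : ℕ) (hk : k ≤ 4) : (faceStep f)^[k] d < hi := by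
  cases k with
  | zero => exact hd.trans_le h.mid_le
  | succ k =>
    rw [Function.iterate_succ_apply']
    exact nextDart_lt h.hi_dvd (h.below d hd k (by omega))

theorem le_iterate {d : ℕ} (hd : d < 4 * N) (hm : mid ≤ d + 4 * t) (k : ℕ) (hk : k ≤ 4) :
    lo ≤ (faceStep f)^[k] d + 4 * t := by
  cases k with
  | zero => exact h.lo_le.trans hm
  | succ k =>
    rw [Function.iterate_succ_apply']
    exact le_nextDart_add h.lo_dvd (h.above d hd hm k (by omega))

/-- A face walk of at most four steps from a dart before `mid` stays below `hi`, where nothing has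
changed. The walks from the other darts are translates of old ones, by `iterate_insertTable_add`. -/
theorem iterate_insertTable_of_lt {d : ℕ} (hd : d < mid) (k : ℕ) (hk : k ≤ 4) :
    (faceStep (insertTable t hi f))^[k] d = (faceStep f)^[k] d := by
  induction k with
  | zero => rfl
  | succ k ih =>
    rw [Function.iterate_succ_apply', Function.iterate_succ_apply', ih (by omega), faceStep,
      insertTable_of_lt (h.iterate_lt hd k (by omega)), faceStep]

theorem iterate_insertTable_add {d : ℕ} (hd : d < 4 * N) (hm : mid ≤ d + 4 * t) (k : ℕ)
    (hk : k ≤ 4) :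
    (faceStep (insertTable t hi f))^[k] (d + 4 * t) = (faceStep f)^[k] d + 4 * t := by
  induction k with
  | zero => rfl
  | succ k ih =>
    rw [Function.iterate_succ_apply', Function.iterate_succ_apply', ih (by omega), faceStep,
      h.insertTable_add (h.le_iterate hd hm k (by omega)), nextDart_add, faceStep]

theorem exists_add {d : ℕ} (hd : d < 4 * (N + t)) (hm : mid ≤ d) :
    ∃ e < 4 * N, mid ≤ e + 4 * t ∧ d = e + 4 * t := by
  have := h.lt_mid
  exact ⟨d - 4 * t, by omega, by omega, by omega⟩

theorem insertTable_add_of_le {d : ℕ} (hm : mid ≤ d + 4 * t) :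
    insertTable t hi f (d + 4 * t) = f d + 4 * t :=
  h.insertTable_add (h.lo_le.trans hm)

theorem insertTable_involutive (hf : ∀ d < 4 * N, f (f d) = d) :
    ∀ d < 4 * (N + t), insertTable t hi f (insertTable t hi f d) = d := by
  intro d hd
  have h2 := h.mid_le
  have h3 := h.hi_le
  by_cases hdm : d < mid
  · have hlt : f d < hi := h.below d hdm 0 (by omega)
    rw [insertTable_of_lt (d := d) (by omega), insertTable_of_lt hlt, hf d (by omega)]
  · obtain ⟨e, he, hme, rfl⟩ := h.exists_add hd (by omega)
    have hle : lo ≤ f e + 4 * t := h.above e he hme 0 (by omega)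
    rw [h.insertTable_add_of_le hme, h.insertTable_add hle, hf e he]

theorem isPeriodicTable_insertTable :
    IsPeriodicTable t lo mid hi (N + t) (insertTable t hi f) where
  lt_mid := h.lt_mid
  mid_lt := by have := h.mid_lt; omega
  mid_dvd := h.mid_dvd
  lo_dvd := h.lo_dvd
  hi_dvd := h.hi_dvd
  lo_le := h.lo_le
  mid_le := h.mid_le
  hi_le := by have := h.hi_le; omega
  periodic := by
    intro d hd hlo
    rw [insertTable_of_lt hd, insertTable_of_lt (by omega), h.periodic d hd hlo]
  below := by
    intro d hd k hk
    rw [h.iterate_insertTable_of_lt hd k (by omega),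
      insertTable_of_lt (h.iterate_lt hd k (by omega))]
    exact h.below d hd k hk
  above := by
    intro d hd hm k hk
    by_cases hdm : d < mid
    · rw [h.iterate_insertTable_of_lt hdm k (by omega),
        insertTable_of_lt (h.iterate_lt hdm k (by omega))]
      exact h.above d (by have := h.mid_le; have := h.hi_le; omega) hm k hk
    · obtain ⟨e, he, hme, rfl⟩ := h.exists_add hd (by omega)
      rw [h.iterate_insertTable_add he hme k (by omega),
        h.insertTable_add (h.le_iterate he hme k (by omega))]
      have := h.above e he hme k hk
      omega
  two := by
    intro d hd hm
    rw [h.iterate_insertTable_of_lt hd 2 (by omega)]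
    exact h.two d hd hm
  three := by
    intro d hd hm
    rw [h.iterate_insertTable_of_lt hd 3 (by omega)]
    exact h.three d hd hm

/-- The new darts correspond to the old intervals `[0, mid)` and `[mid - 4 * t, 4 * N)`. Their
overlap is counted twice, but by `hne` it contributes nothing. -/
theorem count_insertTable {k : ℕ} (hk : k ≤ 4)
    (hne : ∀ d < mid, mid ≤ d + 4 * t → (faceStep f)^[k] d ≠ d) :
    Nat.count (fun d => (faceStep (insertTable t hi f))^[k] d = d) (4 * (N + t)) =
      Nat.count (fun d => (faceStep f)^[k] d = d) (4 * N) := by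
  obtain ⟨m, rfl⟩ := Nat.exists_eq_add_of_le h.lt_mid.le
  obtain ⟨l, hl⟩ := Nat.exists_eq_add_of_le h.mid_lt.le
  rw [show 4 * (N + t) = 4 * t + m + (4 * t + l) by omega, hl, Nat.count_add _ (4 * t + m),
    Nat.count_add _ (4 * t + m),
    Nat.count_congr_of_lt (n := 4 * t + m) (q := fun d => (faceStep f)^[k] d = d) fun d hd => by rw [h.iterate_insertTable_of_lt hd k hk],
    Nat.count_congr_of_lt (n := 4 * t + l) (q := fun d => (faceStep f)^[k] (m + d) = m + d)
      fun d hd => by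
        rw [show 4 * t + m + d = m + d + 4 * t by ring,
          h.iterate_insertTable_add (by omega) (by omega) k hk]
        omega,
    Nat.count_add _ (4 * t) l,
    Nat.count_congr_of_lt (n := 4 * t) (q := fun _ => False) fun d hd => by
      simpa using hne (m + d) (by omega) (by omega),
    Nat.count_congr_of_lt (n := l)
      (q := fun d => (faceStep f)^[k] (4 * t + m + d) = 4 * t + m + d) fun d _ => by
        rw [show m + (4 * t + d) = 4 * t + m + d by ring]]
  simp

theorem isHedriteTable_insertTable {i : ℕ} (hf : IsHedriteTable i N f) :
    IsHedriteTable i (N + t) (insertTable t hi f) where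
  two_le := by have := hf.two_le; omega
  lt := by
    intro d hd
    have h2 := h.mid_le
    have h3 := h.hi_le
    by_cases hdm : d < mid
    · rw [insertTable_of_lt (by omega)]
      have := hf.lt d (by omega)
      omega
    · obtain ⟨e, he, hme, rfl⟩ := h.exists_add hd (by omega)
      rw [h.insertTable_add_of_le hme]
      have := hf.lt e he
      omega
  invol := h.insertTable_involutive hf.invol
  ne := by
    intro d hd
    have h2 := h.mid_le
    have h3 := h.hi_le
    by_cases hdm : d < mid
    · rw [insertTable_of_lt (by omega)]
      exact hf.ne d (by omega)
    · obtain ⟨e, he, hme, rfl⟩ := h.exists_add hd (by omega)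
      rw [h.insertTable_add_of_le hme]
      have := hf.ne e he
      omega
  face_ne := by
    intro d hd
    have h2 := h.mid_le
    have h3 := h.hi_le
    by_cases hdm : d < mid
    · have := h.iterate_insertTable_of_lt hdm 1 (by omega)
      simp only [Function.iterate_one] at this
      rw [this]
      exact hf.face_ne d (by omega)
    · obtain ⟨e, he, hme, rfl⟩ := h.exists_add hd (by omega)
      have := h.iterate_insertTable_add he hme 1 (by omega)
      simp only [Function.iterate_one] at this
      rw [this]
      have := hf.face_ne e he
      omega
  face := by
    intro d hd
    have h2 := h.mid_le
    have h3 := h.hi_le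
    by_cases hdm : d < mid
    · rw [h.iterate_insertTable_of_lt hdm 2 (by omega), h.iterate_insertTable_of_lt hdm 3 (by omega),
        h.iterate_insertTable_of_lt hdm 4 (by omega)]
      exact hf.face d (by omega)
    · obtain ⟨e, he, hme, rfl⟩ := h.exists_add hd (by omega)
      rw [h.iterate_insertTable_add he hme 2 (by omega), h.iterate_insertTable_add he hme 3 (by omega),
        h.iterate_insertTable_add he hme 4 (by omega)]
      have := hf.face e he
      omega
  two := by
    rw [h.count_insertTable (by omega) h.two]
    exact hf.two
  three := by
    rw [h.count_insertTable (by omega) h.three]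
    exact hf.three
  smaller := by
    intro j hj h0
    have h2 := h.mid_le
    have h3 := h.hi_le
    have h4 := h.mid_dvd
    by_cases hjm : 4 * j < mid
    · obtain ⟨r, hr, hlt⟩ := hf.smaller j (by omega) h0
      refine ⟨r, hr, ?_⟩
      rwa [insertTable_of_lt (by omega)]
    · have h5 := h.lt_mid
      obtain ⟨j, rfl⟩ := Nat.exists_eq_add_of_le (show t ≤ j by omega)
      obtain ⟨r, hr, hlt⟩ := hf.smaller j (by omega) (by omega)
      refine ⟨r, hr, ?_⟩
      rw [show 4 * (t + j) + r = (4 * j + r) + 4 * t by ring, h.insertTable_add_of_le (by omega)]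
      omega
  larger := by
    intro j hj h0
    have h2 := h.mid_le
    have h3 := h.hi_le
    have h4 := h.mid_dvd
    have h7 := h.mid_lt
    by_cases hjm : 4 * j < mid
    · obtain ⟨r, hr, hlt⟩ := hf.larger j (by omega) (by omega)
      refine ⟨r, hr, ?_⟩
      rwa [insertTable_of_lt (by omega)]
    · have h5 := h.lt_mid
      obtain ⟨j, rfl⟩ := Nat.exists_eq_add_of_le (show t ≤ j by omega)
      obtain ⟨r, hr, hlt⟩ := hf.larger j (by omega) (by omega)
      refine ⟨r, hr, ?_⟩
      rw [show 4 * (t + j) + r = (4 * j + r) + 4 * t by ring, h.insertTable_add_of_le (by omega)]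
      omega
  jump := by
    intro j hj h0 h1
    have h2 := h.mid_le
    have h3 := h.hi_le
    have h4 := h.mid_dvd
    have h7 := h.mid_lt
    by_cases hjm : 4 * j < mid
    · obtain ⟨d, hd, hlt⟩ := hf.jump j (by omega) h0 (by omega)
      refine ⟨d, hd, ?_⟩
      rwa [insertTable_of_lt (by omega)]
    · have h5 := h.lt_mid
      obtain ⟨j, rfl⟩ := Nat.exists_eq_add_of_le (show t ≤ j by omega)
      obtain ⟨d, hd, hlt⟩ := hf.jump j (by omega) (by omega) (by omega)
      refine ⟨d + 4 * t, by omega, ?_⟩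
      have hd4 := hf.lt d (by omega)
      -- The start `d` of the jumping edge may lie too low for translation, but its end `f d` does
      -- not. The translated edge is read from that end and then reversed by involutivity.
      have he := h.insertTable_add_of_le (d := f d) (by omega)
      rw [hf.invol d (by omega)] at he
      rw [← he, h.insertTable_involutive hf.invol _ (by omega)]
      omega

end IsPeriodicTable

theorem IsPeriodicTable.exists_isHedriteTable_add {t lo mid hi N i : ℕ} {f : ℕ → ℕ}
    (h : IsPeriodicTable t lo mid hi N f) (hf : IsHedriteTable i N f) (m : ℕ) :
    ∃ g, IsPeriodicTable t lo mid hi (N + t * m) g ∧ IsHedriteTable i (N + t * m) g := by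
  induction m with
  | zero => exact ⟨f, h, hf⟩
  | succ m ih =>
    obtain ⟨g, hg, hg'⟩ := ih
    rw [Nat.mul_succ, ← Nat.add_assoc]
    exact ⟨insertTable t hi g, hg.isPeriodicTable_insertTable, hg.isHedriteTable_insertTable hg'⟩

/-! ### Explicit tubes and caps, and the existence of the five families. -/

instance (i N : ℕ) (f : ℕ → ℕ) : Decidable (IsHedriteTable i N f) :=
  decidable_of_iff (2 ≤ N ∧ (∀ d < 4 * N, f d < 4 * N) ∧ (∀ d < 4 * N, f (f d) = d) ∧
    (∀ d < 4 * N, f d ≠ d) ∧ (∀ d < 4 * N, faceStep f d ≠ d) ∧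
    (∀ d < 4 * N, (faceStep f)^[2] d = d ∨ (faceStep f)^[3] d = d ∨ (faceStep f)^[4] d = d) ∧
    Nat.count (fun d => (faceStep f)^[2] d = d) (4 * N) + 2 * i = 16 ∧
    Nat.count (fun d => (faceStep f)^[3] d = d) (4 * N) + 24 = 6 * i ∧
    (∀ j < N, 0 < j → ∃ r < 4, f (4 * j + r) < 4 * j) ∧
    (∀ j < N, j + 1 < N → ∃ r < 4, 4 * j + 4 ≤ f (4 * j + r)) ∧
    (∀ j < N, 0 < j → j + 1 < N → ∃ d < 4 * j, 4 * j + 4 ≤ f d))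
    ⟨fun ⟨h1, h2, h3, h4, h5, h6, h7, h8, h9, h10, h11⟩ =>
      ⟨h1, h2, h3, h4, h5, h6, h7, h8, h9, h10, h11⟩,
    fun ⟨h1, h2, h3, h4, h5, h6, h7, h8, h9, h10, h11⟩ =>
      ⟨h1, h2, h3, h4, h5, h6, h7, h8, h9, h10, h11⟩⟩

instance (t lo mid hi N : ℕ) (f : ℕ → ℕ) : Decidable (IsPeriodicTable t lo mid hi N f) :=
  decidable_of_iff (4 * t < mid ∧ mid < 4 * N ∧ 4 ∣ mid ∧ 4 ∣ lo ∧ 4 ∣ hi ∧ lo ≤ mid ∧ mid ≤ hi ∧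
    hi ≤ 4 * N ∧ (∀ d < hi, lo ≤ d → f d = f (d - 4 * t) + 4 * t) ∧
    (∀ d < mid, ∀ k < 4, f ((faceStep f)^[k] d) < hi) ∧
    (∀ d < 4 * N, mid ≤ d + 4 * t → ∀ k < 4, lo ≤ f ((faceStep f)^[k] d) + 4 * t) ∧
    (∀ d < mid, mid ≤ d + 4 * t → (faceStep f)^[2] d ≠ d) ∧
    (∀ d < mid, mid ≤ d + 4 * t → (faceStep f)^[3] d ≠ d))
    ⟨fun ⟨h1, h2, h3, h4, h5, h6, h7, h8, h9, h10, h11, h12, h13⟩ =>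
      ⟨h1, h2, h3, h4, h5, h6, h7, h8, h9, h10, h11, h12, h13⟩,
    fun ⟨h1, h2, h3, h4, h5, h6, h7, h8, h9, h10, h11, h12, h13⟩ =>
      ⟨h1, h2, h3, h4, h5, h6, h7, h8, h9, h10, h11, h12, h13⟩⟩

/-- The partner of `d` in a list of pairs, or `e` if `d` does not occur. -/
def partnerD (e d : ℕ) : List (ℕ × ℕ) → ℕ
  | [] => e
  | p :: l => if d = p.1 then p.2 else if d = p.2 then p.1 else partnerD e d l

/-- The dart corresponding to `d` when a tube with `N` vertices is turned around. -/
def turn (N d : ℕ) : ℕ := 4 * (N - 1 - d / 4) + (d + 2) % 4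

/-- The table of a tube of `4`-gons closed by two caps: the dart `d` is opposite to
`d + steps[d % steps.length]`, unless it is listed in the first cap, or in the second cap when the
tube is turned around. -/
def capTable (steps : List ℤ) (cap cap' : List (ℕ × ℕ)) (N d : ℕ) : ℕ :=
  partnerD (partnerD (d + steps.getD (d % steps.length) 0).toNat d
    (cap'.map fun p => (turn N p.1, turn N p.2))) d cap

/-- Only the table of size `N₀` has to contain a long periodic stretch. Smaller sizes, where the
caps may interact, are verified one by one. -/
theorem exists_isHedrite_of_tables {i t lo mid hi k N₀ n : ℕ} (F : ℕ → ℕ → ℕ)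
    (hp : IsPeriodicTable t lo mid hi N₀ (F N₀))
    (hF : ∀ N < N₀ + 1, k ≤ N → N % t = N₀ % t → IsHedriteTable i N (F N))
    (hk : k ≤ N₀) (hn : k ≤ n) (hmod : n % t = N₀ % t) :
    ∃ G : CombMap, G.IsHedrite i ∧ G.numVertices = n := by
  rcases Nat.lt_or_ge n (N₀ + 1) with h | h
  · exact (hF n h hn hmod).exists_isHedrite
  · obtain ⟨m, hm⟩ := (Nat.modEq_iff_dvd' (by omega : N₀ ≤ n)).1 hmod.symm
    obtain ⟨g, -, hg⟩ := hp.exists_isHedriteTable_add (hF N₀ (by omega) hk rfl) m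
    rw [← hm, Nat.add_sub_cancel' (by omega : N₀ ≤ n)] at hg
    exact hg.exists_isHedrite

/-- The tube obtained from the square grid by dividing out the translation by `(2, 2)`. -/
def tubeTwoTwo : List ℤ := [6, -6, -14, 6, 14, -6, -6, 6]

/-- The tube obtained from the square grid by dividing out the translation by `(4, 2)`. -/
def tubeFourTwo : List ℤ := [10, -10, -10, 18, 10, -18, -10, 10]

/-- The tube obtained from the square grid by dividing out the translation by `(3, 1)`. -/
def tubeThreeOne : List ℤ := [6, 14, -6, -14]

/-- The tube obtained from the square grid by dividing out the translation by `(5, 1)`. -/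
def tubeFiveOne : List ℤ := [6, 22, -6, -22]

/-- A cap of `tubeTwoTwo` with two `2`-gons. -/
def twoTwoCapA : List (ℕ × ℕ) := [(5, 0), (6, 3), (9, 2), (10, 1)]

/-- A cap of `tubeTwoTwo` with one `2`-gon and two `3`-gons. -/
def twoTwoCapB : List (ℕ × ℕ) := [(1, 6), (2, 5)]

/-- A cap of `tubeFourTwo` with two `2`-gons. -/
def fourTwoCapA : List (ℕ × ℕ) := [(1, 9), (2, 6), (5, 13)]

/-- A cap of `tubeFourTwo` with one `2`-gon and two `3`-gons. -/
def fourTwoCapB : List (ℕ × ℕ) := [(9, 0), (10, 21), (13, 3), (14, 4), (17, 7), (1, 6), (2, 5)]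

/-- A cap of `tubeThreeOne` with one `2`-gon and two `3`-gons. -/
def threeOneCapB : List (ℕ × ℕ) := [(2, 11), (3, 7)]

/-- A cap of `tubeFiveOne` with one `2`-gon and two `3`-gons. -/
def fiveOneCapB : List (ℕ × ℕ) := [(2, 19), (3, 15), (7, 11)]

/-- A cap of `tubeFiveOne` with four `3`-gons. -/
def fiveOneCapC : List (ℕ × ℕ) := [(6, 23), (7, 0), (11, 3), (15, 2), (19, 1)]

/-- The opposite darts in the octahedron. -/
def octahedronTable : List ℕ :=
  [4, 8, 12, 16, 0, 19, 20, 9, 1, 7, 23, 13, 2, 11, 22, 17, 3, 15, 21, 5, 6, 18, 14, 10]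

theorem exists_four_hedrite {n : ℕ} (hn : 2 ≤ n) (heven : Even n) :
    ∃ G : CombMap, G.IsHedrite 4 ∧ G.numVertices = n := by
  rcases Nat.lt_or_ge n 4 with h | h
  · obtain rfl : n = 2 := by
      rcases heven with ⟨m, rfl⟩
      omega
    -- Two vertices joined by four parallel edges.
    exact IsHedriteTable.exists_isHedrite (f := fun d => [4, 7, 6, 5, 0, 3, 2, 1].getD d 0)
      (by decide +kernel)
  · exact exists_isHedrite_of_tables (t := 2) (lo := 20) (mid := 36) (hi := 52) (k := 4) (N₀ := 16)
      (capTable tubeTwoTwo twoTwoCapA twoTwoCapA) (by decide +kernel) (by decide +kernel)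
      (by omega) h (Nat.even_iff.1 heven)

/-- Both tubes have a period of two vertices, so each settles one parity of `n`. -/
theorem exists_five_hedrite {n : ℕ} (hn : 3 ≤ n) (h4 : n ≠ 4) :
    ∃ G : CombMap, G.IsHedrite 5 ∧ G.numVertices = n := by
  rcases Nat.mod_two_eq_zero_or_one n with h | h
  · exact exists_isHedrite_of_tables (t := 2) (lo := 24) (mid := 48) (hi := 72) (k := 6) (N₀ := 24)
      (capTable tubeFourTwo fourTwoCapA fourTwoCapB) (by decide +kernel) (by decide +kernel)
      (by omega) (by omega) h
  · exact exists_isHedrite_of_tables (t := 2) (lo := 20) (mid := 36) (hi := 52) (k := 3) (N₀ := 15)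
      (capTable tubeTwoTwo twoTwoCapA twoTwoCapB) (by decide +kernel) (by decide +kernel)
      (by omega) hn h

/-- In this tube the vertices form a single helix, `j` being adjacent to `j ± 1` and `j ± 3`; hence
vertices can be inserted one at a time. The same holds for `tubeFiveOne`, with `j ± 1` and `j ± 5`.
-/
theorem exists_six_hedrite {n : ℕ} (hn : 4 ≤ n) :
    ∃ G : CombMap, G.IsHedrite 6 ∧ G.numVertices = n :=
  exists_isHedrite_of_tables (t := 1) (lo := 16) (mid := 32) (hi := 48) (k := 4) (N₀ := 15)
    (capTable tubeThreeOne threeOneCapB threeOneCapB) (by decide +kernel) (by decide +kernel)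
    (by omega) hn (by omega)

theorem exists_seven_hedrite {n : ℕ} (hn : 7 ≤ n) :
    ∃ G : CombMap, G.IsHedrite 7 ∧ G.numVertices = n :=
  exists_isHedrite_of_tables (t := 1) (lo := 24) (mid := 48) (hi := 72) (k := 7) (N₀ := 24)
    (capTable tubeFiveOne fiveOneCapB fiveOneCapC) (by decide +kernel) (by decide +kernel)
    (by omega) hn (by omega)

theorem exists_eight_hedrite {n : ℕ} (hn : 6 ≤ n) (h7 : n ≠ 7) :
    ∃ G : CombMap, G.IsHedrite 8 ∧ G.numVertices = n := by
  rcases Nat.lt_or_ge n 8 with h | h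
  · obtain rfl : n = 6 := by omega
    exact IsHedriteTable.exists_isHedrite (f := fun d => octahedronTable.getD d 0)
      (by decide +kernel)
  · exact exists_isHedrite_of_tables (t := 1) (lo := 28) (mid := 52) (hi := 76) (k := 8) (N₀ := 25)
      (capTable tubeFiveOne fiveOneCapC fiveOneCapC) (by decide +kernel) (by decide +kernel)
      (by omega) h (by omega)

/-! ### Connectedness in terms of darts. -/

namespace CombMap

/-- Connectedness makes the group generated by `rot` and `opp` transitive on darts: membership in
`S` spreads along a walk in the underlying graph. -/
theorem IsPlane.mem_of_closed {G : CombMap} (h : G.IsPlane) {S : Set G.Dart}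
    (hrot : ∀ d, G.rot d ∈ S ↔ d ∈ S) (hopp : ∀ d ∈ S, G.opp d ∈ S) (hS : S.Nonempty)
    (d : G.Dart) : d ∈ S := by
  have key : ∀ {x y}, orbitOf G.rot x = orbitOf G.rot y → x ∈ S → y ∈ S := fun hxy hx =>
    (Equiv.Perm.SameCycle.apply_eq (g := fun d => d ∈ S) (fun d => propext (hrot d))
      ((orbitOf_eq_iff _).1 hxy)).mp hx
  obtain ⟨c, hc⟩ := hS
  obtain ⟨p⟩ := h.1.preconnected (orbitOf G.rot c) (orbitOf G.rot d)
  suffices ∀ v w (_ : G.underlying.Walk v w), (∀ x, orbitOf G.rot x = v → x ∈ S) →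
      ∀ x, orbitOf G.rot x = w → x ∈ S from
    this _ _ p (fun x hx => key hx.symm hc) d rfl
  intro v w p
  induction p with
  | nil => exact id
  | cons hadj _ ih =>
    intro hv
    obtain ⟨-, y, hy, hy'⟩ := hadj
    exact ih fun x hx => key (hy'.trans hx.symm) (hopp y (hv y hy))

end CombMap

/-! ### Excluding small vertex numbers by exhaustive search. -/

/-- A partial table of opposite darts. -/
abbrev PartialTable : Type := List (Option ℕ)

namespace PartialTable

/-- The opposite of the dart `d`, if known. -/
def get (l : PartialTable) (d : ℕ) : Option ℕ := l.getD d none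

/-- The `k`-th dart after `d` on the boundary of its face, if known. -/
def walk (l : PartialTable) : ℕ → ℕ → Option ℕ
  | 0, d => some d
  | k + 1, d => match l.get d with
    | none => none
    | some b => l.walk k (nextDart b)

/-- The end of the known part of the boundary of a face and its length, at least `1` if the end
has no known opposite. -/
def chain (l : PartialTable) : ℕ → ℕ → ℕ → ℕ × ℕ
  | 0, _, d => (0, d)
  | k + 1, s, d => match l.get d with
    | none => (s + 1, d)
    | some b => l.chain k (s + 1) (nextDart b)

/-- A dart whose opposite is unknown, at the end of a long chain. -/
def pick (l : PartialTable) : ℕ :=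
  ((List.range l.length).foldl (fun best d =>
    let c := l.chain 4 0 d
    if best.1 < c.1 then c else best) (0, 0)).2

/-- The partial table cannot be completed in such a way that there are just `p₂`, `p₃` and `p₄`
faces of the sizes `2`, `3` and `4`, and no others. -/
def conflict (p₂ p₃ p₄ : ℕ) (l : PartialTable) : Bool :=
  (List.range l.length).any (fun d => l.walk 1 d = some d) ||
  (List.range l.length).any (fun d => (l.walk 4 d).any (· ≠ d) && (l.walk 3 d).any (· ≠ d) &&
    (l.walk 2 d).any (· ≠ d)) ||
  decide (2 * p₂ < Nat.count (fun d => l.walk 2 d = some d) l.length) ||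
  decide (3 * p₃ < Nat.count (fun d => l.walk 3 d = some d) l.length) ||
  decide (4 * p₄ < Nat.count (fun d => (l.walk 3 d).any (· ≠ d) && (l.walk 2 d).any (· ≠ d))
    l.length)

/-- The table in which `a` and `b` have become opposite. -/
def join (l : PartialTable) (a b : ℕ) : PartialTable := (l.set a (some b)).set b (some a)

/-- A search that ascertains that no completion of the partial table describes a connected map with
`n` vertices and with `p₂`, `p₃` and `p₄` faces of the sizes `2`, `3` and `4`. -/
def refute (n p₂ p₃ p₄ : ℕ) : ℕ → PartialTable → Bool
  | 0, _ => false
  | fuel + 1, l => l.conflict p₂ p₃ p₄ ||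
    if l.all Option.isSome then decide (0 < l.length ∧ l.length < 4 * n) else
      decide (l.pick < l.length) && (l.get l.pick).isNone &&
      (List.range l.length).all (fun b => decide (b = l.pick) || (l.get b).isSome ||
        refute n p₂ p₃ p₄ fuel (l.join l.pick b)) &&
      (decide (4 * n ≤ l.length) ||
        refute n p₂ p₃ p₄ fuel (join (l ++ [none, none, none, none]) l.pick l.length))

end PartialTable

namespace PartialTable

theorem get_eq_none {l : PartialTable} {d : ℕ} (hd : l.length ≤ d) : l.get d = none := by
  unfold get
  rw [List.getD_eq_default _ _ hd]

theorem get_set {l : PartialTable} {a d : ℕ} {v : Option ℕ} (ha : a < l.length) :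
    get (l.set a v) d = if d = a then v else l.get d := by
  unfold get
  rw [List.getD_eq_getElem?_getD, List.getD_eq_getElem?_getD, List.getElem?_set]
  by_cases h : d = a
  · subst h
    simp [ha]
  · simp [h, Ne.symm h]

theorem get_append_none (l : PartialTable) (d : ℕ) :
    get (l ++ [none, none, none, none]) d = l.get d := by
  rcases Nat.lt_or_ge d l.length with h | h
  · unfold get
    rw [List.getD_append _ _ _ _ h]
  · rw [get_eq_none h]
    unfold get
    rw [List.getD_append_right _ _ _ _ h]
    rcases (d - l.length) with _ | _ | _ | _ | k <;> simp

/-- The darts of `G` numbered by `e` have the opposites listed in the partial table. -/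
structure Realizes (G : CombMap) (e : ℕ → G.Dart) (l : PartialTable) : Prop where
  dvd : 4 ∣ l.length
  inj : ∀ a < l.length, ∀ b < l.length, e a = e b → a = b
  rot : ∀ a < l.length, G.rot (e a) = e (nextDart a)
  opp : ∀ a b, l.get a = some b → b < l.length ∧ G.opp (e a) = e b
  symm : ∀ a b, l.get a = some b → l.get b = some a

namespace Realizes

variable {G : CombMap} {e : ℕ → G.Dart} {l : PartialTable}

theorem lt_of_get {a b : ℕ} (hab : l.get a = some b) : a < l.length := by
  by_contra! hlt
  rw [get_eq_none hlt] at hab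
  cases hab

theorem nextDart_lt (h : Realizes G e l) {a : ℕ} (ha : a < l.length) : nextDart a < l.length := by
  have := h.dvd
  unfold nextDart
  omega

theorem walk_eq (h : Realizes G e l) (k : ℕ) {a c : ℕ} (ha : a < l.length)
    (hc : l.walk k a = some c) : c < l.length ∧ G.facePerm^[k] (e a) = e c := by
  induction k generalizing a with
  | zero =>
    cases hc
    exact ⟨ha, rfl⟩
  | succ k ih =>
    unfold walk at hc
    split at hc
    · cases hc
    · rename_i b hb
      obtain ⟨hb1, hb2⟩ := h.opp a b hb
      have hn := h.nextDart_lt hb1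
      obtain ⟨h1, h2⟩ := ih hn hc
      refine ⟨h1, ?_⟩
      rw [Function.iterate_succ_apply, ← h2, ← h.rot b hb1, ← hb2]
      rfl

theorem iterate_eq_of_walk (h : Realizes G e l) (k : ℕ) {a : ℕ} (ha : a < l.length)
    (hc : l.walk k a = some a) : G.facePerm^[k] (e a) = e a := (h.walk_eq k ha hc).2

theorem iterate_ne_of_walk (h : Realizes G e l) (k : ℕ) {a : ℕ} (ha : a < l.length)
    (hc : (l.walk k a).any (· ≠ a) = true) : G.facePerm^[k] (e a) ≠ e a := by
  obtain ⟨c, hc1, hc2⟩ := (Option.any_eq_true _ _).1 hc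
  obtain ⟨h1, h2⟩ := h.walk_eq k ha hc1
  rw [h2]
  exact fun hca => (of_decide_eq_true hc2) (h.inj c h1 a ha hca)

theorem count_le (h : Realizes G e l) (p : ℕ → Prop) [DecidablePred p] (q : G.Dart → Prop)
    (hpq : ∀ a < l.length, p a → q (e a)) : Nat.count p l.length ≤ Nat.card {x // q x} := by
  rw [Nat.count_eq_card_filter_range, ← Nat.card_eq_finsetCard]
  have hlt : ∀ a : {a // a ∈ Finset.filter p (Finset.range l.length)}, a.1 < l.length ∧ p a.1 :=
    fun a => by
      have := Finset.mem_filter.1 a.2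
      exact ⟨Finset.mem_range.1 this.1, this.2⟩
  refine Nat.card_le_card_of_injective (fun a => ⟨e a.1, hpq _ (hlt a).1 (hlt a).2⟩) ?_
  intro a b hab
  exact Subtype.ext (h.inj _ (hlt a).1 _ (hlt b).1 (congrArg Subtype.val hab))

theorem join_of_opp (h : Realizes G e l) {a b : ℕ} (ha : a < l.length) (hb : b < l.length)
    (hab : G.opp (e a) = e b) (ha' : l.get a = none) (hb' : l.get b = none) :
    Realizes G e (l.join a b) := by
  have hne : a ≠ b := fun hh => G.opp_ne (e a) (by rw [hab, hh])
  have hget : ∀ c, (l.join a b).get c = if c = b then some a else if c = a then some b else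
      l.get c := fun c => by
    rw [join, get_set (by simpa using hb), get_set ha]
  have hlen : (l.join a b).length = l.length := by simp [join]
  refine ⟨hlen ▸ h.dvd, fun c hc d hd => h.inj c (hlen ▸ hc) d (hlen ▸ hd),
    fun c hc => h.rot c (hlen ▸ hc), ?_, ?_⟩
  · intro c d hcd
    rw [hget] at hcd
    rw [hlen]
    split_ifs at hcd with h1 h2
    · cases hcd
      exact ⟨ha, by rw [h1, ← hab, G.opp_opp]⟩
    · cases hcd
      exact ⟨hb, by rw [h2, hab]⟩
    · exact h.opp c d hcd
  · intro c d hcd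
    rw [hget] at hcd ⊢
    split_ifs at hcd with h1 h2
    · cases hcd
      rw [if_neg hne, if_pos rfl, h1]
    · cases hcd
      rw [if_pos rfl, h2]
    · have hdc := h.symm c d hcd
      rw [if_neg, if_neg, hdc]
      · rintro rfl
        rw [ha'] at hdc
        cases hdc
      · rintro rfl
        rw [hb'] at hdc
        cases hdc

/-- A new vertex may be numbered starting from any of its four darts. This is why the search joins
the picked dart only to the first dart of a new vertex. -/
theorem exists_append (h : Realizes G e l) (hrot : ∀ d, Function.minimalPeriod G.rot d = 4)
    {x : G.Dart} (hx : ∀ a < l.length, e a ≠ x) :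
    ∃ e', Realizes G e' (l ++ [none, none, none, none]) ∧ e' l.length = x ∧
      ∀ a < l.length, e' a = e a := by
  have hlen : (l ++ [none, none, none, none]).length = l.length + 4 := by simp
  have hper : G.rot (G.rot (G.rot (G.rot x))) = x :=
    ((CombMap.minimalPeriod_eq_four_iff).1 (hrot x)).1
  have hne : ∀ j < 4, ∀ a < l.length, e a ≠ G.rot^[j] x := by
    intro j hj
    induction j with
    | zero => exact hx
    | succ j ih =>
      intro a ha hax
      rw [Function.iterate_succ_apply'] at hax
      -- Three steps of `nextDart` undo one, so if one dart at the vertex of `x` were already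
      -- numbered, the preceding one would be too, and finally `x`.
      have hb : nextDart (nextDart (nextDart a)) < l.length :=
        h.nextDart_lt (h.nextDart_lt (h.nextDart_lt ha))
      refine ih (by omega) _ hb (G.rot.injective ?_)
      rw [← hax, h.rot _ hb]
      congr 1
      unfold nextDart
      omega
  have hdvd := h.dvd
  refine ⟨fun c => if c < l.length then e c else G.rot^[c - l.length] x, ⟨?_, ?_, ?_, ?_, ?_⟩,
    ?_, ?_⟩
  · rw [hlen]
    omega
  · intro a ha b hb hab
    rw [hlen] at ha hb
    split_ifs at hab with h1 h2 h2
    · exact h.inj a h1 b h2 hab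
    · exact absurd hab (hne _ (by omega) a h1)
    · exact absurd hab.symm (hne _ (by omega) b h2)
    · have := (Function.iterate_eq_iterate_iff_of_lt_minimalPeriod (f := G.rot) (x := x)
        (m := a - l.length) (n := b - l.length)
        (by rw [hrot]; omega) (by rw [hrot]; omega)).1 hab
      omega
  · intro a ha
    rw [hlen] at ha
    by_cases h1 : a < l.length
    · rw [if_pos h1, if_pos (h.nextDart_lt h1), h.rot a h1]
    · have h2 : ¬ nextDart a < l.length := by
        unfold nextDart
        omega
      rw [if_neg h1, if_neg h2, ← Function.iterate_succ_apply' G.rot]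
      by_cases h3 : a - l.length = 3
      · rw [h3, show nextDart a - l.length = 0 by unfold nextDart; omega]
        exact hper
      · rw [show nextDart a - l.length = (a - l.length) + 1 by unfold nextDart; omega]
  · intro a b hab
    rw [get_append_none] at hab
    have ha := lt_of_get hab
    obtain ⟨hb, hopp⟩ := h.opp a b hab
    rw [if_pos ha, if_pos hb, hlen]
    exact ⟨by omega, hopp⟩
  · intro a b hab
    rw [get_append_none] at hab ⊢
    exact h.symm a b hab
  · simp
  · intro a ha
    exact if_pos ha

end Realizes

/-- The maps excluded by `PartialTable.refute`. -/
structure HasFaceCounts (G : CombMap) (n p₂ p₃ p₄ : ℕ) : Prop where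
  plane : G.IsPlane
  card_dart : Nat.card G.Dart = 4 * n
  rot : ∀ d, Function.minimalPeriod G.rot d = 4
  face : ∀ d, Function.minimalPeriod G.facePerm d = 2 ∨ Function.minimalPeriod G.facePerm d = 3 ∨
    Function.minimalPeriod G.facePerm d = 4
  two : Nat.card {d // Function.minimalPeriod G.facePerm d = 2} = 2 * p₂
  three : Nat.card {d // Function.minimalPeriod G.facePerm d = 3} = 3 * p₃
  four : Nat.card {d // Function.minimalPeriod G.facePerm d = 4} = 4 * p₄

namespace HasFaceCounts

variable {G : CombMap} {n p₂ p₃ p₄ : ℕ} (hG : HasFaceCounts G n p₂ p₃ p₄)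

include hG

theorem facePerm_ne (d : G.Dart) : G.facePerm d ≠ d := fun h => by
  have h1 : Function.minimalPeriod G.facePerm d = 1 := Function.minimalPeriod_eq_one_iff_isFixedPt.2 h
  have := hG.face d
  omega

theorem conflict_eq_false {e : ℕ → G.Dart} {l : PartialTable} (h : Realizes G e l) :
    l.conflict p₂ p₃ p₄ = false := by
  by_contra hc
  rw [Bool.not_eq_false, conflict] at hc
  simp only [Bool.or_eq_true, List.any_eq_true, List.mem_range, decide_eq_true_eq,
    Bool.and_eq_true] at hc
  rcases hc with (((⟨d, hd, h1⟩ | ⟨d, hd, h1⟩) | h1) | h1) | h1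
  · exact hG.facePerm_ne (e d) (h.iterate_eq_of_walk 1 hd h1)
  · have h4 := h.iterate_ne_of_walk 4 hd h1.1.1
    have h3 := h.iterate_ne_of_walk 3 hd h1.1.2
    have h2 := h.iterate_ne_of_walk 2 hd h1.2
    rcases hG.face (e d) with h5 | h5 | h5
    · exact h2 (CombMap.minimalPeriod_eq_two_iff.1 h5).1
    · exact h3 (CombMap.minimalPeriod_eq_three_iff.1 h5).1
    · exact h4 (CombMap.minimalPeriod_eq_four_iff.1 h5).1
  · have := h.count_le (fun d => l.walk 2 d = some d)
      (fun d => Function.minimalPeriod G.facePerm d = 2) fun a ha hw =>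
        CombMap.minimalPeriod_eq_two_iff.2 ⟨h.iterate_eq_of_walk 2 ha hw, hG.facePerm_ne _⟩
    rw [hG.two] at this
    omega
  · have := h.count_le (fun d => l.walk 3 d = some d)
      (fun d => Function.minimalPeriod G.facePerm d = 3) fun a ha hw =>
        CombMap.minimalPeriod_eq_three_iff.2 ⟨h.iterate_eq_of_walk 3 ha hw, hG.facePerm_ne _⟩
    rw [hG.three] at this
    omega
  -- A face need not be closed yet to be counted as a `4`-gon: it suffices that it is known not to
  -- close after two or three steps.
  · have := h.count_le (fun d => (l.walk 3 d).any (· ≠ d) = true ∧ (l.walk 2 d).any (· ≠ d) = true)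
      (fun d => Function.minimalPeriod G.facePerm d = 4) fun a ha hw => by
        have h3 := h.iterate_ne_of_walk 3 ha hw.1
        have h2 := h.iterate_ne_of_walk 2 ha hw.2
        rcases hG.face (e a) with h5 | h5 | h5
        · exact absurd (CombMap.minimalPeriod_eq_two_iff.1 h5).1 h2
        · exact absurd (CombMap.minimalPeriod_eq_three_iff.1 h5).1 h3
        · exact h5
    rw [hG.four] at this
    omega

theorem length_le {e : ℕ → G.Dart} {l : PartialTable} (h : Realizes G e l) :
    l.length ≤ 4 * n := by
  have := h.count_le (fun _ => True) (fun _ => True) fun _ _ _ => trivial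
  rw [Nat.count_true, Nat.card_congr (Equiv.subtypeUnivEquiv fun _ => trivial), hG.card_dart] at this
  exact this

/-- With all opposites known, the numbered darts are closed under `rot` and `opp`, so by
connectedness they are all the darts. -/
theorem length_eq_of_complete {e : ℕ → G.Dart} {l : PartialTable} (h : Realizes G e l)
    (hl : l.all Option.isSome = true) (h0 : 0 < l.length) : l.length = 4 * n := by
  have hsome : ∀ a < l.length, ∃ b, l.get a = some b := by
    intro a ha
    rw [List.all_eq_true] at hl
    have := hl l[a] (List.getElem_mem ha)
    rw [Option.isSome_iff_exists] at this
    unfold get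
    rwa [List.getD_eq_getElem _ _ ha]
  have hrot : ∀ d, d ∈ {x | ∃ a < l.length, e a = x} →
      G.rot d ∈ {x | ∃ a < l.length, e a = x} := by
    rintro _ ⟨a, ha, rfl⟩
    exact ⟨nextDart a, h.nextDart_lt ha, (h.rot a ha).symm⟩
  have hall := hG.plane.mem_of_closed (S := {x | ∃ a < l.length, e a = x}) (fun d => ⟨fun hd => ?_,
    hrot d⟩) ?_ ⟨e 0, 0, h0, rfl⟩
  · have := Nat.card_le_card_of_surjective (fun a : Fin l.length => e a) fun d => by
      obtain ⟨a, ha, rfl⟩ := hall d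
      exact ⟨⟨a, ha⟩, rfl⟩
    rw [Nat.card_fin, hG.card_dart] at this
    exact le_antisymm (hG.length_le h) this
  · have := hrot _ (hrot _ (hrot _ hd))
    rwa [(CombMap.minimalPeriod_eq_four_iff.1 (hG.rot d)).1] at this
  · rintro _ ⟨a, ha, rfl⟩
    obtain ⟨b, hb⟩ := hsome a ha
    obtain ⟨hb1, hb2⟩ := h.opp a b hb
    exact ⟨b, hb1, hb2.symm⟩

/-- The opposite of the picked dart is an unmatched numbered dart or lies at a new vertex, and both
branches are refuted. The heuristic `pick` needs no correctness proof, since the search itself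
checks that the dart is unmatched. -/
theorem not_realizes_of_refute (fuel : ℕ) (l : PartialTable)
    (hl : refute n p₂ p₃ p₄ fuel l = true) (e : ℕ → G.Dart) : ¬ Realizes G e l := by
  induction fuel generalizing l e with
  | zero => cases hl
  | succ fuel ih =>
    intro h
    rw [refute, hG.conflict_eq_false h, Bool.false_or] at hl
    split_ifs at hl with hall
    · have := of_decide_eq_true hl
      have := hG.length_eq_of_complete h hall this.1
      omega
    · simp only [Bool.and_eq_true, Bool.or_eq_true, decide_eq_true_eq, List.all_eq_true,
        List.mem_range, Option.isNone_iff_eq_none] at hl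
      obtain ⟨⟨⟨hlt, hnone⟩, hold⟩, hnew⟩ := hl
      by_cases hx : ∃ b < l.length, e b = G.opp (e l.pick)
      · obtain ⟨b, hb, hbx⟩ := hx
        -- If `b` were already matched, its partner would be the picked dart, which is unmatched.
        have hbnone : l.get b = none := by
          by_contra hb1
          obtain ⟨c, hc⟩ := Option.ne_none_iff_exists'.1 hb1
          obtain ⟨hc1, hc2⟩ := h.opp b c hc
          rw [hbx, G.opp_opp] at hc2
          have hcb := h.symm b c hc
          rw [← h.inj _ hlt _ hc1 hc2, hnone] at hcb
          cases hcb
        rcases hold b hb with (hb1 | hb1) | hb1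
        · rw [hb1] at hbx
          exact G.opp_ne _ hbx.symm
        · rw [hbnone] at hb1
          cases hb1
        · exact ih _ hb1 e (h.join_of_opp hlt hb hbx.symm hnone hbnone)
      · push Not at hx
        obtain ⟨e', h', hlast, hagree⟩ := h.exists_append hG.rot hx
        rcases hnew with hnew | hnew
        · have := hG.length_le h'
          simp at this
          omega
        · refine ih _ hnew e' (h'.join_of_opp (by simp; omega) (by simp) ?_ ?_ ?_)
          · rw [hlast, hagree _ hlt]
          · rw [get_append_none, hnone]
          · rw [get_append_none, get_eq_none le_rfl]

theorem refute_eq_false (hn : 0 < n) (fuel : ℕ) :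
    refute n p₂ p₃ p₄ fuel [none, none, none, none] = false := by
  by_contra hc
  rw [Bool.not_eq_false] at hc
  have : Nonempty G.Dart := by
    by_contra hne
    rw [not_nonempty_iff] at hne
    have := hG.card_dart
    rw [Nat.card_of_isEmpty] at this
    omega
  obtain ⟨d⟩ := this
  have h0 : Realizes G (fun _ => d) [] :=
    ⟨by simp, fun a ha => by simp at ha, fun a ha => by simp at ha, fun a b hab => by
      simp [get] at hab, fun a b hab => by simp [get] at hab⟩
  obtain ⟨e, he, -⟩ := h0.exists_append hG.rot (x := d) (fun a ha => by simp at ha)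
  exact hG.not_realizes_of_refute fuel _ hc e he

end HasFaceCounts

end PartialTable

/-! ### Cohomology modulo `2`: even faces make a plane map bipartite. -/

namespace CombMap

variable {G : CombMap}

theorem facePerm_opp (d : G.Dart) : G.facePerm (G.opp d) = G.rot d := by
  show G.rot (G.opp (G.opp d)) = G.rot d
  rw [G.opp_opp]

theorem orbitOf_facePerm_rot (d : G.Dart) :
    orbitOf G.facePerm (G.rot d) = orbitOf G.facePerm (G.opp d) := by
  rw [← facePerm_opp, orbitOf_apply]

theorem orbitOf_opp_eq_iff (d e : G.Dart) :
    orbitOf G.opp d = orbitOf G.opp e ↔ d = e ∨ d = G.opp e := by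
  constructor
  · intro h
    refine (Equiv.Perm.SameCycle.apply_eq (g := fun x => x = e ∨ x = G.opp e) (fun x => ?_)
      ((orbitOf_eq_iff _).1 h)).mpr (Or.inl rfl)
    have h1 : G.opp x = G.opp e ↔ x = e := G.opp.apply_eq_iff_eq
    have h2 : G.opp x = e ↔ x = G.opp e :=
      ⟨fun hx => by rw [← hx, G.opp_opp], fun hx => by rw [hx, G.opp_opp]⟩
    rw [h1, h2, or_comm]
  · rintro (rfl | rfl)
    · rfl
    · exact orbitOf_apply _ _

theorem sum_edge {M : Type*} [AddCommMonoid M] [DecidableEq G.Edge] (x : G.Dart → M)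
    (d : G.Dart) :
    (∑ e, if orbitOf G.opp e = orbitOf G.opp d then x e else 0) = x d + x (G.opp d) := by
  classical
  rw [← Finset.sum_filter, show Finset.filter (fun e => orbitOf G.opp e = orbitOf G.opp d)
    Finset.univ = {d, G.opp d} by ext e; simp [orbitOf_opp_eq_iff],
    Finset.sum_pair (G.opp_ne d).symm]

section Homology

open Classical in
/-- The coboundary map of `G` modulo `2`. -/
noncomputable def coboundary (G : CombMap) : (G.Vertex → ZMod 2) →ₗ[ZMod 2] (G.Edge → ZMod 2) where
  toFun g e := ∑ d, if orbitOf G.opp d = e then g (orbitOf G.rot d) else 0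
  map_add' g h := by
    ext e
    simp only [Pi.add_apply, ← Finset.sum_add_distrib]
    exact Finset.sum_congr rfl fun d _ => by split_ifs <;> simp
  map_smul' c g := by
    ext e
    simp only [Pi.smul_apply, Finset.smul_sum, RingHom.id_apply]
    exact Finset.sum_congr rfl fun d _ => by split_ifs <;> simp

open Classical in
theorem coboundary_apply (g : G.Vertex → ZMod 2) (d : G.Dart) :
    G.coboundary g (orbitOf G.opp d) = g (orbitOf G.rot d) + g (orbitOf G.rot (G.opp d)) :=
  sum_edge (fun d => g (orbitOf G.rot d)) d

/-- The pairing of the faces of `G` with the edges, modulo `2`. -/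
noncomputable def facePairing (G : CombMap) :
    (G.Face → ZMod 2) →ₗ[ZMod 2] Module.Dual (ZMod 2) (G.Edge → ZMod 2) :=
  LinearMap.mk₂ (ZMod 2) (fun h c => ∑ d, c (orbitOf G.opp d) * h (orbitOf G.facePerm d))
    (fun h h' c => by simp only [Pi.add_apply, mul_add, Finset.sum_add_distrib])
    (fun a h c => by
      simp only [Pi.smul_apply, smul_eq_mul, Finset.mul_sum]
      exact Finset.sum_congr rfl fun d _ => by ring)
    (fun h c c' => by simp only [Pi.add_apply, add_mul, Finset.sum_add_distrib])
    (fun a h c => by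
      simp only [Pi.smul_apply, smul_eq_mul, Finset.mul_sum]
      exact Finset.sum_congr rfl fun d _ => by ring)

theorem facePairing_apply (h : G.Face → ZMod 2) (c : G.Edge → ZMod 2) :
    G.facePairing h c = ∑ d, c (orbitOf G.opp d) * h (orbitOf G.facePerm d) := rfl

/-- The boundary of a boundary vanishes: `rot d` and `opp d` lie on the same face, so each corner is
counted twice. -/
theorem facePairing_coboundary (h : G.Face → ZMod 2) (g : G.Vertex → ZMod 2) :
    G.facePairing h (G.coboundary g) = 0 := by
  simp only [facePairing_apply, coboundary_apply, add_mul, Finset.sum_add_distrib]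
  have h1 : ∑ d, g (orbitOf G.rot (G.opp d)) * h (orbitOf G.facePerm d) =
      ∑ d, g (orbitOf G.rot d) * h (orbitOf G.facePerm d) := by
    rw [← Equiv.sum_comp G.rot fun d => g (orbitOf G.rot d) * h (orbitOf G.facePerm d),
      ← Equiv.sum_comp G.opp fun d => g (orbitOf G.rot (G.opp d)) * h (orbitOf G.facePerm d)]
    simp only [orbitOf_apply, orbitOf_facePerm_rot, G.opp_opp]
  rw [h1]
  exact CharTwo.add_self_eq_zero _

theorem facePairing_single [DecidableEq G.Edge] (h : G.Face → ZMod 2) (d : G.Dart) :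
    G.facePairing h (Pi.single (orbitOf G.opp d) 1) =
      h (orbitOf G.facePerm d) + h (orbitOf G.facePerm (G.opp d)) := by
  rw [facePairing_apply, ← sum_edge (fun d => h (orbitOf G.facePerm d))]
  exact Finset.sum_congr rfl fun e _ => by simp [Pi.single_apply]

/-- Kernel elements are constant by transitivity on darts. The permutation `π` is arbitrary so as to
serve both vertices and faces. -/
theorem IsPlane.finrank_ker_le (hG : G.IsPlane) {π : Equiv.Perm G.Dart} {M : Type*}
    [AddCommGroup M] [Module (ZMod 2) M] (A : (Orbit π → ZMod 2) →ₗ[ZMod 2] M)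
    (hrot : ∀ g ∈ LinearMap.ker A, ∀ d, g (orbitOf π (G.rot d)) = g (orbitOf π d))
    (hopp : ∀ g ∈ LinearMap.ker A, ∀ d, g (orbitOf π (G.opp d)) = g (orbitOf π d)) :
    Module.finrank (ZMod 2) (LinearMap.ker A) ≤ 1 := by
  obtain ⟨v⟩ := hG.1.nonempty
  obtain ⟨d₀, -⟩ := orbitOf_surjective _ v
  have hconst : ∀ g ∈ LinearMap.ker A, ∀ d, g (orbitOf π d) = g (orbitOf π d₀) :=
    fun g hg => hG.mem_of_closed (S := {d | g (orbitOf π d) = g (orbitOf π d₀)})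
      (fun d => by simp only [Set.mem_ofPred_eq, hrot g hg])
      (fun d hd => by simpa only [Set.mem_ofPred_eq, hopp g hg] using hd) ⟨d₀, rfl⟩
  have hle : LinearMap.ker A ≤ Submodule.span (ZMod 2) {fun _ => 1} := fun g hg =>
    Submodule.mem_span_singleton.2 ⟨g (orbitOf π d₀), funext fun o => by
      obtain ⟨d, rfl⟩ := orbitOf_surjective _ o
      simp [hconst g hg d]⟩
  refine (Submodule.finrank_mono hle).trans ((finrank_span_le_card _).trans ?_)
  simp

/-- One inclusion is `facePairing_coboundary`. For equality, the annihilator has dimension at most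
`E - (V - 1)`, the range at least `F - 1`, and these agree by Euler's formula. -/
theorem IsPlane.range_facePairing (hG : G.IsPlane) :
    LinearMap.range G.facePairing = (LinearMap.range G.coboundary).dualAnnihilator := by
  classical
  have hV : Module.finrank (ZMod 2) (LinearMap.ker G.coboundary) ≤ 1 := by
    refine hG.finrank_ker_le _ (fun g _ d => by rw [orbitOf_apply]) fun g hg d => ?_
    have := congrFun (LinearMap.mem_ker.1 hg) (orbitOf G.opp d)
    rw [coboundary_apply] at this
    exact (CharTwo.add_eq_zero.1 this).symm
  have hF : Module.finrank (ZMod 2) (LinearMap.ker G.facePairing) ≤ 1 := by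
    have hopp : ∀ h ∈ LinearMap.ker G.facePairing, ∀ d,
        h (orbitOf G.facePerm (G.opp d)) = h (orbitOf G.facePerm d) := by
      intro h hh d
      have := facePairing_single h d
      rw [LinearMap.mem_ker.1 hh] at this
      exact (CharTwo.add_eq_zero.1 this.symm).symm
    exact hG.finrank_ker_le _ (fun h hh d => by rw [orbitOf_facePerm_rot, hopp h hh]) hopp
  have := Fintype.ofFinite G.Vertex
  have := Fintype.ofFinite G.Edge
  have := Fintype.ofFinite G.Face
  have h1 := LinearMap.finrank_range_add_finrank_ker G.coboundary
  have h2 := LinearMap.finrank_range_add_finrank_ker G.facePairing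
  have h3 := Subspace.finrank_add_finrank_dualAnnihilator_eq (LinearMap.range G.coboundary)
  have h4 := hG.2
  rw [Module.finrank_fintype_fun_eq_card, ← Nat.card_eq_fintype_card] at h1 h2 h3
  simp only [numVertices, numEdges, numFaces] at h4
  refine Submodule.eq_of_le_of_finrank_le ?_ (by omega)
  rintro _ ⟨h, rfl⟩
  rw [Submodule.mem_dualAnnihilator]
  rintro _ ⟨g, rfl⟩
  exact facePairing_coboundary h g

theorem IsPlane.exists_two_coloring (hG : G.IsPlane) (heven : ∀ f : G.Face, Even (G.faceSize f)) :
    ∃ g : G.Vertex → ZMod 2, ∀ d, g (orbitOf G.rot d) + g (orbitOf G.rot (G.opp d)) = 1 := by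
  classical
  -- The all-ones cochain pairs with a face to its size, which is even; so it is annihilated by all
  -- face functionals and is a coboundary.
  have h1 : (fun _ => 1 : G.Edge → ZMod 2) ∈ LinearMap.range G.coboundary := by
    rw [← Subspace.dualAnnihilator_dualCoannihilator_eq (W := LinearMap.range G.coboundary),
      Submodule.mem_dualCoannihilator, ← hG.range_facePairing]
    rintro _ ⟨h, rfl⟩
    have := Fintype.ofFinite G.Face
    simp only [facePairing_apply, one_mul]
    rw [← Finset.sum_fiberwise (g := orbitOf G.facePerm)]
    refine Finset.sum_eq_zero fun f _ => ?_
    rw [Finset.sum_congr rfl fun d hd => by rw [(Finset.mem_filter.1 hd).2], Finset.sum_const,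
      nsmul_eq_mul]
    have : (Finset.filter (fun d => orbitOf G.facePerm d = f) Finset.univ).card = G.faceSize f := by
      rw [faceSize, orbitSize, Nat.card_eq_fintype_card, Fintype.card_subtype]
    rw [this, (ZMod.natCast_eq_zero_iff_even).2 (heven f), zero_mul]
  obtain ⟨g, hg⟩ := h1
  exact ⟨g, fun d => by rw [← coboundary_apply, hg]⟩

/-- `opp` exchanges the darts at the two colours, and each vertex has four darts, so the colour
classes are equally large. -/
theorem IsPlane.even_numVertices (hG : G.IsPlane) (heven : ∀ f : G.Face, Even (G.faceSize f))
    (hdeg : ∀ v : G.Vertex, G.degree v = 4) : Even G.numVertices := by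
  obtain ⟨g, hg⟩ := hG.exists_two_coloring heven
  have h0 : Nat.card {d // g (orbitOf G.rot d) = 0} = 4 * Nat.card {v : G.Vertex // g v = 0} :=
    card_subtype_orbitOf G.rot (P := fun v => g v = 0) fun v _ => hdeg v
  have h1 : Nat.card {d // g (orbitOf G.rot d) = 0} = Nat.card {d // ¬ g (orbitOf G.rot d) = 0} := by
    refine Nat.card_congr (G.opp.subtypeEquiv fun d => ?_)
    have := hg d
    generalize g (orbitOf G.rot d) = a at *
    generalize g (orbitOf G.rot (G.opp d)) = b at *
    revert a b
    decide
  have h2 : Nat.card {d // g (orbitOf G.rot d) = 0} + Nat.card {d // ¬ g (orbitOf G.rot d) = 0} =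
      Nat.card G.Dart := by
    classical
    rw [← Nat.card_sum]
    exact Nat.card_congr (Equiv.sumCompl _)
  have h3 := card_dart_eq_four_mul hdeg
  exact ⟨Nat.card {v // g v = 0}, by omega⟩

end Homology

/-! ### Necessary conditions and the theorem. -/

namespace IsHedrite

variable {i : ℕ}

theorem hasFaceCounts (h : G.IsHedrite i) :
    PartialTable.HasFaceCounts G G.numVertices (8 - i) (2 * i - 8) (G.numVertices + 2 - i) where
  plane := h.plane
  card_dart := h.card_dart
  rot d := by
    rw [← orbitSize_orbitOf]
    exact h.fourValent _
  face d := by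
    rw [← orbitSize_orbitOf]
    exact h.faceSize_mem _
  two := by
    have h1 := card_orbitSize_eq G.facePerm 2
    have h2 : _ = G.pVector 2 := Nat.eq_sub_of_add_eq h.pVector_two_add |>.symm
    simp only [orbitSize_orbitOf] at h1
    rw [h1, h2]
    rfl
  three := by
    have h1 := card_orbitSize_eq G.facePerm 3
    have h2 : _ = G.pVector 3 := Nat.eq_sub_of_add_eq h.pVector_three_add |>.symm
    simp only [orbitSize_orbitOf] at h1
    rw [h1, h2]
    rfl
  four := by
    have h1 := card_orbitSize_eq G.facePerm 4
    have h2 : _ = G.pVector 4 := Nat.eq_sub_of_add_eq h.pVector_four_add |>.symm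
    simp only [orbitSize_orbitOf] at h1
    rw [h1, h2]
    rfl

theorem le_numVertices (h : G.IsHedrite i) : i ≤ G.numVertices + 2 := by
  have := h.pVector_four_add
  omega

theorem even_numVertices (h : G.IsHedrite 4) : Even G.numVertices := by
  refine h.plane.even_numVertices (fun f => ?_) h.fourValent
  have h3 := h.pVector_three_add
  have hf : G.faceSize f ≠ 3 := fun hf => by
    have : Nonempty {f // G.faceSize f = 3} := ⟨⟨f, hf⟩⟩
    have : 0 < G.pVector 3 := Nat.card_pos
    omega
  rcases h.faceSize_mem f with h1 | h1 | h1
  · exact ⟨1, h1⟩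
  · exact absurd h1 hf
  · exact ⟨2, h1⟩

end IsHedrite

end CombMap

theorem CombMap.IsHedrite.numVertices_ne {G : CombMap} {i n : ℕ} (h : G.IsHedrite i) (hn : 0 < n)
    -- Each search level matches two darts, so `20` exceeds the `2 * n ≤ 14` matchings possible for
    -- `n ≤ 7`.
    (hr : PartialTable.refute n (8 - i) (2 * i - 8) (n + 2 - i) 20 [none, none, none, none] = true) :
    G.numVertices ≠ n := by
  rintro rfl
  rw [h.hasFaceCounts.refute_eq_false hn] at hr
  cases hr

theorem mainTheorem5 (n : ℕ) :
    ((∃ G : CombMap, G.IsHedrite 4 ∧ G.numVertices = n) ↔ 2 ≤ n ∧ Even n) ∧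
    ((∃ G : CombMap, G.IsHedrite 5 ∧ G.numVertices = n) ↔ 3 ≤ n ∧ n ≠ 4) ∧
    ((∃ G : CombMap, G.IsHedrite 6 ∧ G.numVertices = n) ↔ 4 ≤ n) ∧
    ((∃ G : CombMap, G.IsHedrite 7 ∧ G.numVertices = n) ↔ 7 ≤ n) ∧
    ((∃ G : CombMap, G.IsHedrite 8 ∧ G.numVertices = n) ↔ 6 ≤ n ∧ n ≠ 7) := by
  refine ⟨⟨?_, fun h => exists_four_hedrite h.1 h.2⟩, ⟨?_, fun h => exists_five_hedrite h.1 h.2⟩,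
    ⟨?_, exists_six_hedrite⟩, ⟨?_, exists_seven_hedrite⟩,
    ⟨?_, fun h => exists_eight_hedrite h.1 h.2⟩⟩
  · rintro ⟨G, hG, rfl⟩
    have := hG.le_numVertices
    exact ⟨by omega, hG.even_numVertices⟩
  · rintro ⟨G, hG, rfl⟩
    have := hG.le_numVertices
    exact ⟨by omega, hG.numVertices_ne (by omega) (by decide +kernel)⟩
  · rintro ⟨G, hG, rfl⟩
    have := hG.le_numVertices
    omega
  · rintro ⟨G, hG, rfl⟩
    have h1 := hG.le_numVertices
    have h2 : G.numVertices ≠ 5 := hG.numVertices_ne (by omega) (by decide +kernel)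
    have h3 : G.numVertices ≠ 6 := hG.numVertices_ne (by omega) (by decide +kernel)
    omega
  · rintro ⟨G, hG, rfl⟩
    have := hG.le_numVertices
    exact ⟨by omega, hG.numVertices_ne (by omega) (by decide +kernel)⟩
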